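/- Let $d\ge 2$ and $N\ge 2$ be integers. A $1\to N$ cloning map of qudits is a completely positive trace-preserving linear map $\mathcal E$ from the operators on $\mathbb C^d$ to the operators on $(\mathbb C^d)^{\otimes N}$. Its single-copy fidelities are $$F_n(\mathcal E)=\int \mathrm{Tr}\Bigl(\bigl(\mathbb 1^{\otimes(n-1)}\otimes|\psi\rangle\langle\psi|\otimes\mathbb 1^{\otimes(N-n)}\bigr)\,\mathcal E(|\psi\rangle\langle\psi|)\Bigr)\,dU,\qquad |\psi\rangle=U|0\rangle,\quad n=1,\dots,N,$$ where $dU$ is the Haar probability measure on $SU(d)$. A vector $F=(F_1,\dots,F_N)\in\mathbb R^N$ is called achievable if it is the vector of fidelities of some cloning map, and optimal if it is achievable and no other achievable vector $F'$ satisfies $F'_n\ge F_n$ for all $n$. Then: 1. (Trade-off relation.) $F\in\mathbb R^N$ is optimal if and only if $F_n\ge \frac1{d+1}$ for all $n$, $$\frac{(d+1)\sum_nF_n}{N+d-1}=1+\left(\frac{\sum_n\sqrt{F_n(d+1)-1}}{N+d-1}\right)^2,$$ and $\sqrt{F_n(d+1)-1}\ \ge\ \frac{1}{N+d-1}\sum_m\sqrt{F_m(d+1)-1}$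 for all $n$. 2. Every achievable vector $F$ satisfies $F\le F'$ coordinatewise for some optimal vector $F'$. 3. For all weights $\alpha_1,\dots,\alpha_N\ge0$ with $\sum_n\alpha_n=1$, the maximum of $\sum_n\alpha_nF_n$ over the achievable vectors is attained at an optimal vector; conversely, every optimal vector maximises $\sum_n\alpha_nF_n$ over the achievable vectors for some such weights. 4. (Symmetric point.) The vector $(F,\dots,F)$ is optimal if and only if $$F=\frac{2N+d-1}{(d+1)N},$$ and this is also the largest $F$ for which $(F,\dots,F)$ is achievable. -/

import Mathlib

open MeasureTheory
open scoped ComplexOrder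

namespace Cloning

/-- The special unitary group `SU(d)`. -/
abbrev SU (d : ℕ) := Matrix.specialUnitaryGroup (Fin d) ℂ

instance (d : ℕ) : IsTopologicalGroup (SU d) where
  continuous_mul := continuous_mul
  continuous_inv := by
    refine continuous_induced_rng.mpr ?_
    exact continuous_subtype_val.matrix_conjTranspose

instance (d : ℕ) : CompactSpace (SU d) := by
  have hcl : IsClosed {A : Matrix (Fin d) (Fin d) ℂ | A ∈ Matrix.specialUnitaryGroup (Fin d) ℂ} := by
    have h : {A : Matrix (Fin d) (Fin d) ℂ | A ∈ Matrix.specialUnitaryGroup (Fin d) ℂ}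
        = (Matrix.unitaryGroup (Fin d) ℂ : Set (Matrix (Fin d) (Fin d) ℂ))
          ∩ Matrix.det ⁻¹' {1} := by
      ext A
      simp [Matrix.mem_specialUnitaryGroup_iff]
    rw [h]
    exact isClosed_unitary.inter (isClosed_singleton.preimage continuous_id.matrix_det)
  have hK : IsCompact (Set.univ.pi fun _ : Fin d => Set.univ.pi fun _ : Fin d =>
      Metric.closedBall (0 : ℂ) 1) :=
    isCompact_univ_pi fun _ => isCompact_univ_pi fun _ => isCompact_closedBall 0 1
  refine isCompact_iff_compactSpace.mp (hK.of_isClosed_subset hcl ?_)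
  intro A hA i _ j _
  have hA' := (Matrix.mem_specialUnitaryGroup_iff.mp hA).1
  simpa using entry_norm_bound_of_unitary hA' i j

noncomputable instance (d : ℕ) : MeasurableSpace (SU d) := borel _

instance (d : ℕ) : BorelSpace (SU d) := ⟨rfl⟩

/-- The Haar probability measure on `SU(d)`. -/
noncomputable def haarSU (d : ℕ) : Measure (SU d) :=
  Measure.haarMeasure ⊤

instance (d : ℕ) : IsProbabilityMeasure (haarSU d) :=
  ⟨by simpa [haarSU] using
    Measure.haarMeasure_self (K₀ := (⊤ : TopologicalSpace.PositiveCompacts (SU d)))⟩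

/-- The pure state `U |0⟩⟨0| U†`. -/
noncomputable def pureState {d : ℕ} [NeZero d] (U : SU d) : Matrix (Fin d) (Fin d) ℂ :=
  (U : Matrix (Fin d) (Fin d) ℂ) * Matrix.single 0 0 1 * (U : Matrix (Fin d) (Fin d) ℂ).conjTranspose

/-- The operator `𝟙 ⊗ ⋯ ⊗ 𝟙 ⊗ A ⊗ 𝟙 ⊗ ⋯ ⊗ 𝟙` on `(ℂ^d)^{⊗ N}`, with `A` on site `n`. The basis
states of `(ℂ^d)^{⊗ N}` are the functions `Fin N → Fin d`. -/
noncomputable def siteOp {d N : ℕ} (n : Fin N) (A : Matrix (Fin d) (Fin d) ℂ) :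
    Matrix (Fin N → Fin d) (Fin N → Fin d) ℂ :=
  Matrix.of fun x y => ∏ m : Fin N, (if m = n then A else 1) (x m) (y m)

/-- `E` is completely positive: for each `k`, the map `id_k ⊗ E` preserves positive
semidefiniteness. -/
def IsCompletelyPositive {d N : ℕ}
    (E : Matrix (Fin d) (Fin d) ℂ →ₗ[ℂ] Matrix (Fin N → Fin d) (Fin N → Fin d) ℂ) : Prop :=
  ∀ (k : ℕ) (X : Matrix (Fin k × Fin d) (Fin k × Fin d) ℂ), X.PosSemidef →
    (Matrix.of fun p q : Fin k × (Fin N → Fin d) =>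
      E (Matrix.of fun i j => X (p.1, i) (q.1, j)) p.2 q.2).PosSemidef

/-- A `1 → N` cloning map of qudits: a completely positive trace-preserving linear map from
operators on `ℂ^d` to operators on `(ℂ^d)^{⊗ N}`. -/
structure IsCloner {d N : ℕ}
    (E : Matrix (Fin d) (Fin d) ℂ →ₗ[ℂ] Matrix (Fin N → Fin d) (Fin N → Fin d) ℂ) : Prop where
  completelyPositive : IsCompletelyPositive E
  tracePreserving : ∀ X, (E X).trace = X.trace

/-- The fidelity `F_n = ∫ Tr(|ψ⟩⟨ψ|_n E(|ψ⟩⟨ψ|)) dψ` of the `n`-th clone, where the input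
`|ψ⟩ = U |0⟩` is drawn uniformly. -/
noncomputable def fidelity {d N : ℕ} [NeZero d]
    (E : Matrix (Fin d) (Fin d) ℂ →ₗ[ℂ] Matrix (Fin N → Fin d) (Fin N → Fin d) ℂ)
    (n : Fin N) : ℝ :=
  ∫ U : SU d, (siteOp n (pureState U) * E (pureState U)).trace.re ∂(haarSU d)

/-- `F` is the vector of single-copy fidelities of some cloning map. -/
def Achievable (d : ℕ) {N : ℕ} [NeZero d] (F : Fin N → ℝ) : Prop :=
  ∃ E : Matrix (Fin d) (Fin d) ℂ →ₗ[ℂ] Matrix (Fin N → Fin d) (Fin N → Fin d) ℂ,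
    IsCloner E ∧ ∀ n, fidelity E n = F n

end Cloning

namespace Cloning

/-! Put `y_n = F_n (d+1) - 1` and `x_n = √y_n`. The second moments of a random pure state turn `y_n`
into the overlap of the Choi operator with the maximally entangled state of the input and clone `n`
(`fidelity_eq_overlap`). The trade-off then expresses monogamy of entanglement: the projections onto
these states for two different clones have product of norm `1/d`.

Upper bound. Factor the Choi operator into a vector `ψ`, project it onto each maximally entangled
state, and apply Cauchy-Schwarz to `ψ` against nonnegative combinations of the projected vectors.
With `G = (d-1)1 + J`, `J` the all-ones matrix, this gives `(b·x)² ≤ b·Gb` for all `b ≥ 0`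
(`IsCloner.fidelity_bound`, in the variables `b = γ x`). Nonnegative least squares for `G` converts
this family of inequalities into a single `β ≥ 0` with `β·Gβ = 1` and `x ≤ Gβ`
(`exists_dominating`).

Achievability. The cloner with Kraus operators `|i⟩ ↦ ∑ m, β m |a⋯a i a⋯a⟩`, one for each `a`, is
trace preserving exactly when `β·Gβ = 1`, and then `y_n = (Gβ)_n²` (`achievable_of_amplitudes`).
Hence every achievable vector lies below the surface `x = Gβ`. Two comparable surface points
coincide (`eq_of_gramMul_le`), so the surface is exactly the set of optimal vectors. Solving `x =
Gβ` for `β` gives the trade-off equation, with `β ≥ 0` as the last inequality. The weights `β_n /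
x_n`, once normalised, support the achievable set at the surface point (`sum_weights_le_one`). -/

/-! ### Second moments of Haar-random pure states -/

lemma continuous_pureState {d : ℕ} [NeZero d] : Continuous (pureState (d := d)) := by
  unfold pureState
  exact (continuous_subtype_val.mul continuous_const).mul
    continuous_subtype_val.matrix_conjTranspose

lemma pureState_apply {d : ℕ} [NeZero d] (U : SU d) (i j : Fin d) :
    pureState U i j = U.1 i 0 * star (U.1 j 0) := by
  simp [pureState, Matrix.mul_apply, Matrix.single_apply, Finset.sum_ite_eq, ite_and]

/-- A `d`-th root of `(det V)⁻¹` is a phase that moves `V` into `SU(d)`, and the phase cancels in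
the conjugation; left invariance of Haar measure does the rest. -/
lemma integral_pureState_conj {d : ℕ} [NeZero d] {V : Matrix (Fin d) (Fin d) ℂ}
    (hV : V * V.conjTranspose = 1) (f : Matrix (Fin d) (Fin d) ℂ → ℂ) :
    ∫ U, f (V * pureState U * V.conjTranspose) ∂(haarSU d) = ∫ U, f (pureState U) ∂(haarSU d) := by
  have hdet : V.det * star V.det = 1 := by
    rw [← Matrix.det_conjTranspose, ← Matrix.det_mul, hV, Matrix.det_one]
  have hne : V.det ≠ 0 := left_ne_zero_of_mul_eq_one hdet
  obtain ⟨c, hc⟩ := IsAlgClosed.exists_pow_nat_eq (V.det)⁻¹ (NeZero.pos d)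
  have hnorm : ‖c‖ = 1 := by
    have h1 : ‖V.det‖ = 1 := by
      have := congrArg norm hdet
      rw [norm_mul, norm_star, norm_one] at this
      nlinarith [norm_nonneg V.det]
    have h2 : ‖c‖ ^ d = 1 := by rw [← norm_pow, hc, norm_inv, h1, inv_one]
    exact (pow_eq_one_iff_of_nonneg (norm_nonneg c) (NeZero.ne d)).1 h2
  have hcc : c * star c = 1 := by
    rw [Complex.star_def, Complex.mul_conj, Complex.normSq_eq_norm_sq, hnorm]; simp
  have hmem : c • V ∈ Matrix.specialUnitaryGroup (Fin d) ℂ := by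
    rw [Matrix.mem_specialUnitaryGroup_iff, Matrix.mem_unitaryGroup_iff]
    constructor
    · rw [Matrix.star_eq_conjTranspose, Matrix.conjTranspose_smul, Matrix.smul_mul, Matrix.mul_smul,
        smul_smul, hcc, hV, one_smul]
    · rw [Matrix.det_smul, Fintype.card_fin, hc, inv_mul_cancel₀ hne]
  have key : ∀ U : SU d, pureState ((⟨c • V, hmem⟩ : SU d) * U)
      = V * pureState U * V.conjTranspose := by
    intro U
    simp only [pureState, Submonoid.coe_mul, Matrix.conjTranspose_mul, Matrix.conjTranspose_smul,
      Matrix.smul_mul, Matrix.mul_smul, smul_smul, Matrix.mul_assoc]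
    rw [mul_comm, hcc, one_smul]
  have : (haarSU d).IsMulLeftInvariant := by unfold haarSU; infer_instance
  have := integral_mul_left_eq_self (μ := haarSU d) (fun U => f (pureState U))
    (⟨c • V, hmem⟩ : SU d)
  simpa only [key] using this

/-- The second moments `∫ P_ij P_kl` of the entries of a random pure state `P`. -/
noncomputable def secondMoment {d : ℕ} [NeZero d] (i j k l : Fin d) : ℂ :=
  ∫ U : SU d, pureState U i j * pureState U k l ∂(haarSU d)

lemma integrable_pureState_mul {d : ℕ} [NeZero d] (i j k l : Fin d) :
    Integrable (fun U : SU d => pureState U i j * pureState U k l) (haarSU d) := by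
  refine Continuous.integrable_of_hasCompactSupport ?_ (HasCompactSupport.of_compactSpace _)
  exact (continuous_pureState.matrix_elem i j).mul (continuous_pureState.matrix_elem k l)

/-- Conjugation by a diagonal unitary with entry `I` at one well-chosen index multiplies an unpaired
moment by `I` or `-1`, so the moment vanishes. -/
lemma secondMoment_eq_zero {d : ℕ} [NeZero d] {i j k l : Fin d}
    (h : ¬ ((i = j ∧ k = l) ∨ (i = l ∧ k = j))) : secondMoment i j k l = 0 := by
  have inv : ∀ a : Fin d, secondMoment i j k l =
      ((Function.update 1 a Complex.I : Fin d → ℂ) i *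
        star ((Function.update 1 a Complex.I : Fin d → ℂ) j) *
        (Function.update 1 a Complex.I : Fin d → ℂ) k *
        star ((Function.update 1 a Complex.I : Fin d → ℂ) l)) * secondMoment i j k l := by
    intro a
    set z : Fin d → ℂ := Function.update 1 a Complex.I with hz
    have hV : Matrix.diagonal z * (Matrix.diagonal z).conjTranspose = 1 := by
      rw [Matrix.diagonal_conjTranspose, Matrix.diagonal_mul_diagonal, ← Matrix.diagonal_one]
      congr 1; ext b
      by_cases hb : b = a
      · subst hb; simp [hz]
      · simp [hz, hb]
    have h := integral_pureState_conj hV (fun P => P i j * P k l)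
    rw [secondMoment, ← integral_const_mul]
    refine h.symm.trans (integral_congr_ae (Filter.Eventually.of_forall fun U => ?_))
    simp only [Matrix.diagonal_conjTranspose, Matrix.mul_diagonal, Matrix.diagonal_mul, Pi.star_apply]
    ring
  have cancel : ∀ {t w : ℂ}, w = t * w → t ≠ 1 → w = 0 := by
    intro t w hw ht
    have : (1 - t) * w = 0 := by linear_combination hw
    exact (mul_eq_zero.1 this).resolve_left (sub_ne_zero.2 ht.symm)
  have hI : Complex.I ≠ 1 := fun h => by simpa using congrArg Complex.re h
  by_cases hij : i = j
  · have hkl : l ≠ k := fun hkl => h (Or.inl ⟨hij, hkl.symm⟩)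
    refine cancel (inv k) ?_
    subst hij
    by_cases hik : i = k
    · subst hik; simpa [hkl] using hI
    · simpa [hkl, hik] using hI
  by_cases hil : i = l
  · have hkj : j ≠ k := fun hkj => h (Or.inr ⟨hil, hkj.symm⟩)
    refine cancel (inv k) ?_
    subst hil
    by_cases hik : i = k
    · subst hik; simpa [hkj] using hI
    · simpa [hkj, hik] using hI
  · refine cancel (inv i) ?_
    by_cases hik : k = i
    · subst hik; simp [Ne.symm hij, Ne.symm hil]; norm_num
    · simpa [Ne.symm hij, Ne.symm hil, hik] using hI

lemma secondMoment_swap {d : ℕ} [NeZero d] (i j k l : Fin d) :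
    secondMoment i j k l = secondMoment i l k j := by
  unfold secondMoment
  congr 1; ext U
  simp only [pureState_apply]; ring

lemma secondMoment_comm {d : ℕ} [NeZero d] (i j k l : Fin d) :
    secondMoment i j k l = secondMoment k l i j := by
  unfold secondMoment
  congr 1; ext U
  ring

/-- Invariance under a unitary that mixes `i` and `k` with amplitudes of equal modulus links the
diagonal moments to the mixed ones, which diagonal unitaries cannot do. -/
lemma four_mul_secondMoment {d : ℕ} [NeZero d] {i k : Fin d} (hik : i ≠ k) :
    4 * secondMoment i i i i =
      secondMoment i i i i + secondMoment k k k k + 4 * secondMoment i i k k := by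
  -- `R` projects onto `(e_i + e_k)/√2`; the unitary `V` below multiplies that vector by `I` and
  -- fixes its orthogonal complement.
  set R : Matrix (Fin d) (Fin d) ℂ :=
    (1 / 2 : ℂ) • (Matrix.single i i 1 + Matrix.single i k 1 + Matrix.single k i 1
      + Matrix.single k k 1) with hR
  have hRH : R.conjTranspose = R := by
    simp only [hR, Matrix.conjTranspose_smul, Matrix.conjTranspose_add,
      Matrix.conjTranspose_single, star_one]
    congr 1
    · simp
    · abel
  have hRR : R * R = R := by
    simp only [hR, Matrix.smul_mul, Matrix.mul_smul, add_mul, mul_add,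
      Matrix.single_mul_single_same, Matrix.single_mul_single_of_ne _ _ _ _ hik,
      Matrix.single_mul_single_of_ne _ _ _ _ hik.symm, mul_one, add_zero, zero_add]
    module
  set V : Matrix (Fin d) (Fin d) ℂ := 1 - (1 - Complex.I) • R with hVdef
  have hVH : V.conjTranspose = 1 - (1 + Complex.I) • R := by
    simp [hVdef, Matrix.conjTranspose_sub, Matrix.conjTranspose_smul, hRH]
  have hV : V * V.conjTranspose = 1 := by
    rw [hVH, hVdef]
    simp only [sub_mul, mul_sub, Matrix.smul_mul, Matrix.mul_smul, smul_smul, hRR, mul_one, one_mul]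
    have : (1 + Complex.I) * Complex.I = Complex.I - 1 := by
      linear_combination Complex.I_sq
    rw [this]
    module
  have hrow : ∀ b, V i b = (if b = i then (1 + Complex.I) / 2 else 0)
      + (if b = k then -(1 - Complex.I) / 2 else 0) := by
    intro b
    simp only [hVdef, hR, Matrix.sub_apply, Matrix.smul_apply, Matrix.add_apply,
      Matrix.single_apply, Matrix.one_apply, smul_eq_mul]
    by_cases hbi : b = i
    · subst hbi; simp [hik, hik.symm]; ring
    · by_cases hbk : b = k
      · subst hbk; simp [hik, hik.symm]; ring
      · simp [Ne.symm hbi, Ne.symm hbk, hbi, hbk, hik.symm]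
  have hcol : ∀ b, V.conjTranspose b i = (if b = i then (1 - Complex.I) / 2 else 0)
      + (if b = k then -(1 + Complex.I) / 2 else 0) := by
    intro b
    rw [Matrix.conjTranspose_apply, hrow]
    by_cases hbi : b = i
    · subst hbi; simp [hik, sub_eq_add_neg]
    · by_cases hbk : b = k
      · subst hbk; simp [hbi, sub_eq_add_neg]
      · simp [hbi, hbk]
  have hent : ∀ P : Matrix (Fin d) (Fin d) ℂ, (V * P * V.conjTranspose) i i =
      (P i i + P k k - Complex.I * P i k + Complex.I * P k i) / 2 := by
    intro P
    simp only [Matrix.mul_apply, hrow, hcol, add_mul, mul_add, Finset.sum_add_distrib, ite_mul,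
      mul_ite, zero_mul, mul_zero, Finset.sum_ite_eq', Finset.mem_univ, if_true]
    ring_nf
    simp only [Complex.I_sq]
    ring
  have h := integral_pureState_conj hV (fun P => P i i * P i i)
  simp only [hent] at h
  have hexp : ∀ U : SU d,
      (pureState U i i + pureState U k k - Complex.I * pureState U i k
          + Complex.I * pureState U k i) / 2 *
        ((pureState U i i + pureState U k k - Complex.I * pureState U i k
          + Complex.I * pureState U k i) / 2)
      = ∑ p : Fin 2 × Fin 2, ∑ q : Fin 2 × Fin 2,
        ((![![1, -Complex.I], ![Complex.I, 1]] p.1 p.2 * ![![1, -Complex.I], ![Complex.I, 1]] q.1 q.2)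
          / 4) * (pureState U (![i, k] p.1) (![i, k] p.2) * pureState U (![i, k] q.1) (![i, k] q.2)) := by
    intro U
    simp only [Fintype.sum_prod_type, Fin.sum_univ_two, Matrix.cons_val_zero, Matrix.cons_val_one]
    ring
  simp only [hexp] at h
  rw [integral_finsetSum _ fun p _ => integrable_finsetSum _ fun q _ =>
    (integrable_pureState_mul _ _ _ _).const_mul _] at h
  simp_rw [integral_finsetSum Finset.univ fun q _ =>
    (integrable_pureState_mul _ _ _ _).const_mul _, integral_const_mul] at h
  change ∑ p : Fin 2 × Fin 2, ∑ q : Fin 2 × Fin 2,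
    ((![![1, -Complex.I], ![Complex.I, 1]] p.1 p.2 * ![![1, -Complex.I], ![Complex.I, 1]] q.1 q.2)
      / 4) * secondMoment (![i, k] p.1) (![i, k] p.2) (![i, k] q.1) (![i, k] q.2)
    = secondMoment i i i i at h
  simp only [Fintype.sum_prod_type, Fin.sum_univ_two, Matrix.cons_val_zero, Matrix.cons_val_one] at h
  have hki := hik.symm
  rw [secondMoment_swap i k k i, secondMoment_swap k i i k, secondMoment_comm k k i i,
    secondMoment_eq_zero (i := i) (j := i) (k := i) (l := k) (by tauto),
    secondMoment_eq_zero (i := i) (j := i) (k := k) (l := i) (by tauto),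
    secondMoment_eq_zero (i := i) (j := k) (k := i) (l := i) (by tauto),
    secondMoment_eq_zero (i := i) (j := k) (k := i) (l := k) (by tauto),
    secondMoment_eq_zero (i := i) (j := k) (k := k) (l := k) (by tauto),
    secondMoment_eq_zero (i := k) (j := i) (k := i) (l := i) (by tauto),
    secondMoment_eq_zero (i := k) (j := i) (k := k) (l := i) (by tauto),
    secondMoment_eq_zero (i := k) (j := i) (k := k) (l := k) (by tauto),
    secondMoment_eq_zero (i := k) (j := k) (k := i) (l := k) (by tauto),
    secondMoment_eq_zero (i := k) (j := k) (k := k) (l := i) (by tauto)] at h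
  linear_combination -4 * h - 2 * secondMoment i i k k * Complex.I_sq

lemma sum_pureState_diag {d : ℕ} [NeZero d] (U : SU d) : ∑ i, pureState U i i = 1 := by
  have hU : U.1.conjTranspose * U.1 = 1 :=
    Matrix.mem_unitaryGroup_iff'.1 (Matrix.mem_specialUnitaryGroup_iff.1 U.2).1
  have := congrFun (congrFun hU 0) 0
  simpa [Matrix.mul_apply, pureState_apply, mul_comm] using this

lemma secondMoment_diag_sum {d : ℕ} [NeZero d] :
    ∑ i : Fin d, ∑ k : Fin d, secondMoment i i k k = 1 := by
  unfold secondMoment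
  simp_rw [← integral_finsetSum Finset.univ fun k _ => integrable_pureState_mul _ _ _ _]
  rw [← integral_finsetSum Finset.univ fun i _ => integrable_finsetSum Finset.univ fun k _ =>
    integrable_pureState_mul _ _ _ _]
  simp_rw [← Finset.mul_sum, sum_pureState_diag, mul_one, sum_pureState_diag]
  simp

/-- Schur orthogonality of second order for random pure states. -/
theorem secondMoment_eq {d : ℕ} [NeZero d] (i j k l : Fin d) :
    secondMoment i j k l =
      ((if i = j ∧ k = l then 1 else 0) + (if i = l ∧ k = j then 1 else 0)) / (d * (d + 1)) := by
  have hd : (d : ℂ) ≠ 0 := Nat.cast_ne_zero.2 (NeZero.ne d)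
  have hd1 : (d : ℂ) + 1 ≠ 0 := by exact_mod_cast Nat.succ_ne_zero d
  -- Subtracting the relation for `(a, 0)` from that for `(0, a)` eliminates the mixed moment.
  have hdiag : ∀ a : Fin d, secondMoment a a a a = secondMoment (0 : Fin d) 0 0 0 := by
    intro a
    by_cases ha : a = 0
    · rw [ha]
    · have h1 := four_mul_secondMoment ha
      have h2 := four_mul_secondMoment (Ne.symm ha)
      rw [secondMoment_comm 0 0 a a] at h2
      linear_combination (h1 - h2) / 4
  have hoff : ∀ {a b : Fin d}, a ≠ b → secondMoment a a b b = secondMoment (0 : Fin d) 0 0 0 / 2 := by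
    intro a b hab
    have h1 := four_mul_secondMoment hab
    rw [hdiag a, hdiag b] at h1
    linear_combination - h1 / 4
  have hval : secondMoment (0 : Fin d) 0 0 0 = 2 / (d * (d + 1)) := by
    have h := secondMoment_diag_sum (d := d)
    have hrow : ∀ a b : Fin d, secondMoment a a b b =
        secondMoment (0 : Fin d) 0 0 0 / 2 + if a = b then secondMoment (0 : Fin d) 0 0 0 / 2 else 0 := by
      intro a b
      by_cases hab : a = b
      · subst hab; rw [hdiag]; simp
      · simp [hab, hoff hab]
    generalize secondMoment (0 : Fin d) 0 0 0 = t at hrow ⊢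
    simp_rw [hrow, Finset.sum_add_distrib, Finset.sum_ite_eq] at h
    simp only [Finset.sum_const, Finset.card_univ, Fintype.card_fin, nsmul_eq_mul,
      Finset.mem_univ, if_true] at h
    field_simp
    linear_combination 2 * h
  by_cases h : (i = j ∧ k = l) ∨ (i = l ∧ k = j)
  · rcases h with ⟨rfl, rfl⟩ | ⟨rfl, rfl⟩
    · by_cases hik : i = k
      · subst hik; rw [hdiag, hval]; norm_num
      · rw [hoff hik, hval]; simp [hik]; field_simp
    · rw [secondMoment_swap]
      by_cases hik : i = k
      · subst hik; rw [hdiag, hval]; norm_num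
      · rw [hoff hik, hval]; simp [hik]; field_simp
  · rw [secondMoment_eq_zero h]
    rw [not_or] at h
    simp [h.1, h.2]

/-! ### Site operators and the entanglement overlap -/

/-- Summing over all `z`, although the summand ignores `z n`, costs a factor `d` but avoids
configurations with site `n` removed. The involution exchanging `i` with `z n` proves it. -/
lemma sum_update_eq {R : Type*} [CommSemiring R] {d N : ℕ} (n : Fin N)
    (h : (Fin N → Fin d) → R) :
    ∑ z, ∑ i, h (Function.update z n i) = d * ∑ x, h x := by
  have hinv : Function.Involutive
      (fun p : (Fin N → Fin d) × Fin d => (Function.update p.1 n p.2, p.1 n)) := by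
    rintro ⟨z, i⟩
    simp
  rw [← Fintype.sum_prod_type' (f := fun z i => h (Function.update z n i))]
  rw [← Equiv.sum_comp hinv.toPerm]
  simp [Fintype.sum_prod_type, Finset.mul_sum]

lemma sum_update_const {R : Type*} [CommSemiring R] {d N : ℕ} (n : Fin N) (j : Fin d)
    (g : (Fin N → Fin d) → R) :
    ∑ z, g (Function.update z n j) = d * ∑ x, if x n = j then g x else 0 := by
  rw [← sum_update_eq n]
  simp

lemma siteOp_apply {d N : ℕ} (n : Fin N) (A : Matrix (Fin d) (Fin d) ℂ) (x y : Fin N → Fin d) :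
    siteOp n A x y = if y = Function.update x n (y n) then A (x n) (y n) else 0 := by
  rw [siteOp, Matrix.of_apply, ← Finset.mul_prod_erase _ _ (Finset.mem_univ n), if_pos rfl]
  split_ifs with h
  · rw [Finset.prod_eq_one, mul_one]
    intro m hm
    have hmn := Finset.ne_of_mem_erase hm
    have hxy : y m = x m := by simpa [hmn] using congrFun h m
    rw [if_neg hmn, hxy, Matrix.one_apply_eq]
  · obtain ⟨m, hm⟩ : ∃ m, y m ≠ Function.update x n (y n) m := by
      by_contra! hc
      exact h (funext hc)
    have hmn : m ≠ n := by rintro rfl; simp at hm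
    rw [Finset.prod_eq_zero (i := m) (by simp [hmn]), mul_zero]
    rw [if_neg hmn, Matrix.one_apply_ne]
    simpa [hmn] using hm.symm

lemma trace_siteOp_mul {d N : ℕ} (n : Fin N) (A : Matrix (Fin d) (Fin d) ℂ)
    (M : Matrix (Fin N → Fin d) (Fin N → Fin d) ℂ) :
    (siteOp n A * M).trace = ∑ x, ∑ i, A (x n) i * M (Function.update x n i) x := by
  simp only [Matrix.trace, Matrix.diag, Matrix.mul_apply, siteOp_apply]
  refine Finset.sum_congr rfl fun x _ => ?_
  simp only [ite_mul, zero_mul]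
  rw [← Finset.sum_filter]
  refine Finset.sum_bij' (fun y _ => y n) (fun i _ => Function.update x n i) ?_ ?_ ?_ ?_ ?_
  · simp
  · simp
  · intro y hy; simpa using (Finset.mem_filter.1 hy).2.symm
  · simp
  · intro y hy; rw [← (Finset.mem_filter.1 hy).2]

lemma trace_siteOp_single_mul {d N : ℕ} (n : Fin N) (i j : Fin d)
    (M : Matrix (Fin N → Fin d) (Fin N → Fin d) ℂ) :
    d * (siteOp n (Matrix.single j i 1) * M).trace =
      ∑ z, M (Function.update z n i) (Function.update z n j) := by
  have h := sum_update_const n j (fun x => M (Function.update x n i) x)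
  simp only [Function.update_idem] at h
  rw [h, trace_siteOp_mul]
  congr 1
  refine Finset.sum_congr rfl fun x _ => ?_
  simp [Matrix.single_apply, ite_and, eq_comm]

/-- The unnormalised overlap of the Choi operator of `E` with the maximally entangled state of the
input and the `n`-th output. -/
noncomputable def overlap {d N : ℕ}
    (E : Matrix (Fin d) (Fin d) ℂ →ₗ[ℂ] Matrix (Fin N → Fin d) (Fin N → Fin d) ℂ)
    (n : Fin N) : ℂ :=
  ∑ i, ∑ j, (siteOp n (Matrix.single j i 1) * E (Matrix.single i j 1)).trace

lemma map_eq_sum_single {d N : ℕ}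
    (E : Matrix (Fin d) (Fin d) ℂ →ₗ[ℂ] Matrix (Fin N → Fin d) (Fin N → Fin d) ℂ)
    (A : Matrix (Fin d) (Fin d) ℂ) (x y : Fin N → Fin d) :
    E A x y = ∑ i, ∑ j, A i j * E (Matrix.single i j 1) x y := by
  conv_lhs => rw [Matrix.matrix_eq_sum_single A]
  simp only [map_sum, Matrix.sum_apply]
  refine Finset.sum_congr rfl fun i _ => Finset.sum_congr rfl fun j _ => ?_
  rw [show Matrix.single i j (A i j) = A i j • Matrix.single i j (1 : ℂ) by simp, map_smul,
    Matrix.smul_apply, smul_eq_mul]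

lemma trace_siteOp_mul_map {d N : ℕ}
    (E : Matrix (Fin d) (Fin d) ℂ →ₗ[ℂ] Matrix (Fin N → Fin d) (Fin N → Fin d) ℂ)
    (n : Fin N) (A : Matrix (Fin d) (Fin d) ℂ) :
    (siteOp n A * E A).trace = ∑ i, ∑ j, ∑ k, ∑ l,
      (siteOp n (Matrix.single k l 1) * E (Matrix.single i j 1)).trace * (A i j * A k l) := by
  have h1 : ∀ M : Matrix (Fin N → Fin d) (Fin N → Fin d) ℂ, (siteOp n A * M).trace
      = ∑ k, ∑ l, (siteOp n (Matrix.single k l 1) * M).trace * A k l := by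
    intro M
    simp only [trace_siteOp_mul, Finset.sum_mul]
    simp_rw [Finset.sum_comm (s := Finset.univ (α := Fin d)) (t := Finset.univ (α := Fin N → Fin d))]
    refine Finset.sum_congr rfl fun x _ => ?_
    simp only [Matrix.single_apply, ite_and, ite_mul, zero_mul, one_mul, Finset.sum_ite_irrel,
      Finset.sum_const_zero, Finset.sum_ite_eq, Finset.sum_ite_eq', Finset.mem_univ, if_true]
    exact Finset.sum_congr rfl fun i _ => mul_comm _ _
  have h2 : E A = ∑ i, ∑ j, A i j • E (Matrix.single i j 1) := by
    ext x y
    simp [map_eq_sum_single E A, Matrix.sum_apply]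
  rw [h2]
  simp only [Finset.mul_sum, Matrix.trace_sum, Matrix.mul_smul, Matrix.trace_smul, smul_eq_mul]
  refine Finset.sum_congr rfl fun i _ => Finset.sum_congr rfl fun j _ => ?_
  rw [h1, Finset.mul_sum]
  refine Finset.sum_congr rfl fun k _ => ?_
  rw [Finset.mul_sum]
  exact Finset.sum_congr rfl fun l _ => by ring

lemma siteOp_one {d N : ℕ} (n : Fin N) : siteOp n (1 : Matrix (Fin d) (Fin d) ℂ) = 1 := by
  ext x y
  rw [siteOp_apply]
  by_cases h : x = y
  · subst h; simp
  · rw [Matrix.one_apply_ne h]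
    split_ifs with h1
    · refine Matrix.one_apply_ne fun h2 => h ?_
      rw [h1, ← h2, Function.update_eq_self]
    · rfl

/-- Of the two index pairings in `secondMoment_eq`, one produces the trace of `E 1`, which is `d`,
and the other the overlap; the average is `(d + overlap) / (d (d+1))`. -/
theorem fidelity_eq_overlap {d N : ℕ} [NeZero d]
    {E : Matrix (Fin d) (Fin d) ℂ →ₗ[ℂ] Matrix (Fin N → Fin d) (Fin N → Fin d) ℂ}
    (hE : ∀ X, (E X).trace = X.trace) (n : Fin N) :
    fidelity E n * (d + 1) - 1 = (overlap E n).re / d := by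
  have hd : (d : ℂ) ≠ 0 := Nat.cast_ne_zero.2 (NeZero.ne d)
  have hd1 : (d : ℂ) + 1 ≠ 0 := by exact_mod_cast Nat.succ_ne_zero d
  have hdr : (d : ℝ) ≠ 0 := Nat.cast_ne_zero.2 (NeZero.ne d)
  have hint : ∀ c i j k l, Integrable
      (fun U : SU d => c * (pureState U i j * pureState U k l)) (haarSU d) :=
    fun c i j k l => (integrable_pureState_mul i j k l).const_mul c
  have hI : Integrable (fun U : SU d => (siteOp n (pureState U) * E (pureState U)).trace)
      (haarSU d) := by
    simp_rw [trace_siteOp_mul_map]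
    exact integrable_finsetSum _ fun i _ => integrable_finsetSum _ fun j _ =>
      integrable_finsetSum _ fun k _ => integrable_finsetSum _ fun l _ => hint _ _ _ _ _
  have hfid : (fidelity E n : ℝ) =
      (∫ U : SU d, (siteOp n (pureState U) * E (pureState U)).trace ∂(haarSU d)).re := by
    rw [fidelity]
    exact Complex.reCLM.integral_comp_comm hI
  have hval : ∫ U : SU d, (siteOp n (pureState U) * E (pureState U)).trace ∂(haarSU d)
      = (d + overlap E n) / (d * (d + 1)) := by
    simp_rw [trace_siteOp_mul_map]
    rw [integral_finsetSum _ fun i _ => integrable_finsetSum _ fun j _ =>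
      integrable_finsetSum _ fun k _ => integrable_finsetSum _ fun l _ => hint _ _ _ _ _]
    simp_rw [integral_finsetSum Finset.univ fun j _ =>
      integrable_finsetSum Finset.univ fun k _ => integrable_finsetSum Finset.univ fun l _ =>
        hint _ _ _ _ _]
    simp_rw [integral_finsetSum Finset.univ fun k _ => integrable_finsetSum Finset.univ fun l _ =>
        hint _ _ _ _ _]
    simp_rw [integral_finsetSum Finset.univ fun l _ => hint _ _ _ _ _, integral_const_mul]
    change ∑ i, ∑ j, ∑ k, ∑ l, _ * secondMoment i j k l = _
    have hdiag : (d : ℂ) = ∑ i : Fin d, ∑ k : Fin d,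
        (siteOp n (Matrix.single k k 1) * E (Matrix.single i i 1)).trace := by
      have h1 : ∀ M : Matrix (Fin N → Fin d) (Fin N → Fin d) ℂ,
          ∑ k, (siteOp n (Matrix.single k k 1) * M).trace = M.trace := by
        intro M
        conv_rhs => rw [← one_mul M, ← siteOp_one n]
        simp only [trace_siteOp_mul]
        rw [Finset.sum_comm]
        refine Finset.sum_congr rfl fun x _ => ?_
        rw [Finset.sum_comm]
        refine Finset.sum_congr rfl fun i _ => ?_
        rw [← Finset.sum_mul]
        congr 1
        simp [Matrix.single_apply, Matrix.one_apply, ite_and, eq_comm]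
      simp [h1, hE, Matrix.trace_single_eq_same]
    simp only [secondMoment_eq, mul_div_assoc', ← Finset.sum_div, mul_add, Finset.sum_add_distrib]
    congr 2
    · rw [hdiag]
      simp [ite_and]
    · rw [overlap]
      simp [ite_and]
  rw [hfid, hval, show ((d : ℂ) + overlap E n) / (d * (d + 1))
    = ((1 / (d * (d + 1)) : ℝ) : ℂ) * (((d : ℝ) : ℂ) + overlap E n) by push_cast; field_simp,
    Complex.re_ofReal_mul, Complex.add_re, Complex.ofReal_re]
  have : (d : ℝ) + 1 ≠ 0 := by positivity
  field_simp
  ring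

/-! ### Kraus factorisation and the monogamy bound -/

/-- `B` is the matrix of a Kraus decomposition of `E`, equivalently of a factorisation of its Choi
operator. -/
def IsKraus {d N : ℕ} {κ : Type*} [Fintype κ]
    (E : Matrix (Fin d) (Fin d) ℂ →ₗ[ℂ] Matrix (Fin N → Fin d) (Fin N → Fin d) ℂ)
    (B : κ → Fin d → (Fin N → Fin d) → ℂ) : Prop :=
  ∀ i j x y, E (Matrix.single i j 1) x y = ∑ k, star (B k i x) * B k j y

lemma overlap_eq_of_isKraus {d N : ℕ} {κ : Type*} [Fintype κ]
    {E : Matrix (Fin d) (Fin d) ℂ →ₗ[ℂ] Matrix (Fin N → Fin d) (Fin N → Fin d) ℂ}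
    {B : κ → Fin d → (Fin N → Fin d) → ℂ} (hB : IsKraus E B) (n : Fin N) :
    d * overlap E n = ((∑ k, ∑ z, ‖∑ i, B k i (Function.update z n i)‖ ^ 2 : ℝ) : ℂ) := by
  rw [overlap, Finset.mul_sum]
  simp_rw [Finset.mul_sum, trace_siteOp_single_mul, hB _ _ _ _]
  push_cast
  simp_rw [← Complex.conj_mul', map_sum, Finset.sum_mul, Finset.mul_sum]
  simp_rw [Finset.sum_comm (s := Finset.univ (α := Fin d)) (t := Finset.univ (α := Fin N → Fin d)),
    Finset.sum_comm (s := Finset.univ (α := Fin d)) (t := Finset.univ (α := κ))]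
  rw [Finset.sum_comm]
  rfl

lemma exists_isKraus {d N : ℕ}
    {E : Matrix (Fin d) (Fin d) ℂ →ₗ[ℂ] Matrix (Fin N → Fin d) (Fin N → Fin d) ℂ}
    (hE : IsCompletelyPositive E) :
    ∃ (m : ℕ) (B : Fin m → Fin d → (Fin N → Fin d) → ℂ), IsKraus E B := by
  -- The unnormalised maximally entangled vector: complete positivity at `k = d` makes the Choi
  -- matrix positive semidefinite.
  let v : Fin d × Fin d → ℂ := fun p => if p.1 = p.2 then 1 else 0
  have hJ := hE d _ (Matrix.posSemidef_vecMulVec_self_star v)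
  obtain ⟨m, B, hB⟩ := Matrix.posSemidef_iff_eq_sum_vecMulVec.1 hJ
  refine ⟨m, fun k i x => star (B k (i, x)), fun i j x y => ?_⟩
  have h := congrFun (congrFun hB (i, x)) (j, y)
  simp only [Matrix.of_apply, Matrix.sum_apply, Matrix.vecMulVec_apply, Pi.star_apply] at h
  simp only [star_star]
  rw [← h]
  have hs : Matrix.single i j (1 : ℂ) = Matrix.of fun a b => v (i, a) * star (v (j, b)) := by
    ext a b
    by_cases ha : i = a <;> simp [v, Matrix.single_apply, ha]
  rw [hs]

lemma sum_norm_sq_of_isKraus {d N : ℕ} {κ : Type*} [Fintype κ]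
    {E : Matrix (Fin d) (Fin d) ℂ →ₗ[ℂ] Matrix (Fin N → Fin d) (Fin N → Fin d) ℂ}
    {B : κ → Fin d → (Fin N → Fin d) → ℂ} (hB : IsKraus E B)
    (hE : ∀ X, (E X).trace = X.trace) :
    ∑ k, ∑ i, ∑ x, ‖B k i x‖ ^ 2 = d := by
  have h : (∑ i, (E (Matrix.single i i 1)).trace) = d := by simp [hE]
  simp only [Matrix.trace, Matrix.diag, hB _ _ _ _] at h
  rw [← Complex.ofReal_inj]
  push_cast
  rw [← h, Finset.sum_comm]
  refine Finset.sum_congr rfl fun i _ => ?_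
  rw [Finset.sum_comm]
  refine Finset.sum_congr rfl fun x _ => Finset.sum_congr rfl fun k _ => ?_
  rw [← Complex.conj_mul']; rfl

/-- A Cauchy-Schwarz estimate for a vector against a family with controlled Gram matrix. -/
lemma sq_sum_overlap_le {H ι : Type*} [NormedAddCommGroup H] [InnerProductSpace ℂ H] [Fintype ι]
    {c : ℝ} (hc : 0 < c) {ψ : H} {u : ι → H} {y : ι → ℝ} (hy : ∀ n, 0 ≤ y n)
    (hψ : ‖ψ‖ ^ 2 = c) (hψu : ∀ n, inner ℂ ψ (u n) = ((c * y n : ℝ) : ℂ))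
    (hu : ∀ n, ‖u n‖ ^ 2 = c ^ 2 * y n)
    (huu : ∀ n m, n ≠ m → ‖inner ℂ (u n) (u m)‖ ≤ c * (√(y n) * √(y m)))
    {γ : ι → ℝ} (hγ : ∀ n, 0 ≤ γ n) :
    (∑ n, γ n * y n) ^ 2 ≤ (c - 1) * ∑ n, γ n ^ 2 * y n + (∑ n, γ n * √(y n)) ^ 2 := by
  classical
  set v : H := ∑ n, (γ n : ℂ) • u n with hv
  have h1 : inner ℂ ψ v = ((c * ∑ n, γ n * y n : ℝ) : ℂ) := by
    simp only [hv, inner_sum, inner_smul_right, hψu]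
    push_cast
    rw [Finset.mul_sum]
    exact Finset.sum_congr rfl fun n _ => by ring
  have h2 : ‖v‖ ^ 2 ≤ c * ((c - 1) * ∑ n, γ n ^ 2 * y n + (∑ n, γ n * √(y n)) ^ 2) := by
    have hin : ((‖v‖ ^ 2 : ℝ) : ℂ) = ∑ n, ∑ m, ((γ n * γ m : ℝ) : ℂ) * inner ℂ (u n) (u m) := by
      push_cast
      refine (inner_self_eq_norm_sq_to_K (𝕜 := ℂ) v).symm.trans ?_
      simp only [hv, inner_sum, sum_inner, inner_smul_right, inner_smul_left, Complex.conj_ofReal]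
      rw [Finset.sum_comm]
      refine Finset.sum_congr rfl fun n _ => ?_
      rw [Finset.mul_sum]
      exact Finset.sum_congr rfl fun m _ => by ring
    -- The diagonal value `c² y n` is split as `c y n + c (c - 1) y n`, so that its first part
    -- completes the off-diagonal bounds to a perfect square.
    have hle : ‖v‖ ^ 2 ≤ ∑ n, ∑ m, γ n * γ m *
        (c * (√(y n) * √(y m)) + if n = m then c * (c - 1) * y n else 0) := by
      rw [← Complex.ofReal_re (‖v‖ ^ 2), hin]
      simp only [Complex.re_sum, Complex.re_ofReal_mul]
      refine Finset.sum_le_sum fun n _ => Finset.sum_le_sum fun m _ =>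
        mul_le_mul_of_nonneg_left ?_ (mul_nonneg (hγ n) (hγ m))
      by_cases hnm : n = m
      · subst hnm
        have : (inner ℂ (u n) (u n)).re = ‖u n‖ ^ 2 := inner_self_eq_norm_sq (𝕜 := ℂ) (u n)
        rw [this, hu, if_pos rfl, Real.mul_self_sqrt (hy n)]
        exact le_of_eq (by ring)
      · rw [if_neg hnm, add_zero]
        exact (Complex.re_le_norm _).trans (huu n m hnm)
    refine hle.trans (le_of_eq ?_)
    simp only [mul_add, Finset.sum_add_distrib, mul_ite, mul_zero, Finset.sum_ite_eq,
      Finset.mem_univ, if_true]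
    rw [sq (∑ n, γ n * √(y n)), Finset.sum_mul_sum]
    simp only [Finset.mul_sum]
    rw [add_comm]
    congr 1
    · exact Finset.sum_congr rfl fun n _ => by ring
    · exact Finset.sum_congr rfl fun n _ => Finset.sum_congr rfl fun m _ => by ring
  have h3 : (c * ∑ n, γ n * y n) ^ 2 ≤ c * ‖v‖ ^ 2 := by
    have h := norm_inner_le_norm (𝕜 := ℂ) ψ v
    rw [h1, Complex.norm_real, Real.norm_eq_abs] at h
    rw [← hψ, ← mul_pow, ← sq_abs (_ * _)]
    rw [hψ]
    exact pow_le_pow_left₀ (abs_nonneg _) h 2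
  have h4 : c ^ 2 * (∑ n, γ n * y n) ^ 2
      ≤ c ^ 2 * ((c - 1) * ∑ n, γ n ^ 2 * y n + (∑ n, γ n * √(y n)) ^ 2) := by
    nlinarith [mul_le_mul_of_nonneg_left h2 hc.le]
  exact le_of_mul_le_mul_left h4 (by positivity)

theorem IsCloner.fidelity_bound {d N : ℕ} [NeZero d]
    {E : Matrix (Fin d) (Fin d) ℂ →ₗ[ℂ] Matrix (Fin N → Fin d) (Fin N → Fin d) ℂ}
    (hE : IsCloner E) :
    (∀ n, 0 ≤ fidelity E n * (d + 1) - 1) ∧ ∀ γ : Fin N → ℝ, (∀ n, 0 ≤ γ n) →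
      (∑ n, γ n * (fidelity E n * (d + 1) - 1)) ^ 2 ≤
        (d - 1) * ∑ n, γ n ^ 2 * (fidelity E n * (d + 1) - 1)
          + (∑ n, γ n * √(fidelity E n * (d + 1) - 1)) ^ 2 := by
  obtain ⟨K, B, hB⟩ := exists_isKraus hE.completelyPositive
  have hd : (0 : ℝ) < d := Nat.cast_pos.2 (NeZero.pos d)
  set y : Fin N → ℝ := fun n => fidelity E n * (d + 1) - 1 with hydef
  set w : Fin N → Fin K → (Fin N → Fin d) → ℂ :=
    fun n k z => ∑ i, B k i (Function.update z n i) with hw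
  have hwup : ∀ n k z i, w n k (Function.update z n i) = w n k z := by
    intro n k z i; simp [hw]
  have hW : ∀ n, ∑ k, ∑ z, ‖w n k z‖ ^ 2 = d ^ 2 * y n := by
    intro n
    have h := congrArg Complex.re (overlap_eq_of_isKraus hB n)
    rw [Complex.ofReal_re, ← Complex.ofReal_natCast, Complex.re_ofReal_mul] at h
    rw [hydef]
    simp only
    rw [fidelity_eq_overlap hE.tracePreserving, ← h]
    field_simp
  have hy : ∀ n, 0 ≤ y n := by
    intro n
    have h : 0 ≤ (d : ℝ) ^ 2 * y n := by
      rw [← hW]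
      exact Finset.sum_nonneg fun k _ => Finset.sum_nonneg fun z _ => by positivity
    exact nonneg_of_mul_nonneg_right h (by positivity)
  refine ⟨hy, fun γ hγ => ?_⟩
  let ψ : EuclideanSpace ℂ (Fin K × Fin d × (Fin N → Fin d)) :=
    WithLp.toLp 2 fun p => B p.1 p.2.1 p.2.2
  -- `u n` is `d` times the projection of `ψ` onto the maximally entangled state of the input and
  -- site `n`.
  let u : Fin N → EuclideanSpace ℂ (Fin K × Fin d × (Fin N → Fin d)) := fun n =>
    WithLp.toLp 2 fun p => if p.2.1 = p.2.2 n then w n p.1 p.2.2 else 0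
  refine sq_sum_overlap_le (ψ := ψ) (u := u) hd hy ?_ ?_ ?_ ?_ hγ
  · rw [EuclideanSpace.norm_sq_eq]
    simp only [ψ, Fintype.sum_prod_type]
    exact sum_norm_sq_of_isKraus hB hE.tracePreserving
  · intro n
    have hdc : (d : ℂ) ≠ 0 := Nat.cast_ne_zero.2 (NeZero.ne d)
    have h1 : inner ℂ ψ (u n) = ∑ k, ∑ x, w n k x * star (B k (x n) x) := by
      simp only [ψ, u, PiLp.inner_apply, Fintype.sum_prod_type, RCLike.inner_apply, ite_mul, zero_mul]
      refine Finset.sum_congr rfl fun k _ => ?_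
      rw [Finset.sum_comm]
      simp
    have h2 : (d : ℂ) * inner ℂ ψ (u n) = ((∑ k, ∑ z, ‖w n k z‖ ^ 2 : ℝ) : ℂ) := by
      rw [h1, Finset.mul_sum]
      push_cast
      refine Finset.sum_congr rfl fun k _ => ?_
      rw [← sum_update_eq n]
      refine Finset.sum_congr rfl fun z _ => ?_
      simp only [hwup, Function.update_self]
      rw [← Finset.mul_sum, ← star_sum, ← Complex.mul_conj']
      rfl
    rw [hW] at h2
    apply mul_left_cancel₀ hdc
    rw [h2]; push_cast; ring
  · intro n
    rw [EuclideanSpace.norm_sq_eq, ← hW]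
    simp only [u, Fintype.sum_prod_type]
    refine Finset.sum_congr rfl fun k _ => ?_
    rw [Finset.sum_comm]
    refine Finset.sum_congr rfl fun x _ => ?_
    rw [Finset.sum_eq_single (x n)] <;> simp +contextual
  · intro n m hnm
    -- Since `w n` does not depend on `x n`, imposing `x n = x m` keeps a fraction `1/d` of the sum.
    -- This is the source of the factor `1/d` in monogamy.
    have hhalf : ∀ n m, n ≠ m →
        ∑ k, ∑ x, (if x n = x m then ‖w n k x‖ ^ 2 else 0) = d * y n := by
      intro n m hnm
      have : (d : ℝ) * ∑ k, ∑ x, (if x n = x m then ‖w n k x‖ ^ 2 else 0) = d * (d * y n) := by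
        rw [show (d : ℝ) * (d * y n) = d ^ 2 * y n by ring, ← hW, Finset.mul_sum]
        refine Finset.sum_congr rfl fun k _ => ?_
        rw [← sum_update_eq n]
        refine Finset.sum_congr rfl fun z _ => ?_
        simp [hwup, Function.update_of_ne hnm.symm]
      exact mul_left_cancel₀ hd.ne' this
    have h1 : inner ℂ (u n) (u m) = ∑ p : Fin K × (Fin N → Fin d),
        if p.2 n = p.2 m then w m p.1 p.2 * star (w n p.1 p.2) else 0 := by
      simp only [u, PiLp.inner_apply, Fintype.sum_prod_type, RCLike.inner_apply]
      refine Finset.sum_congr rfl fun k _ => ?_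
      rw [Finset.sum_comm]
      refine Finset.sum_congr rfl fun x _ => ?_
      rw [Finset.sum_eq_single (x n)]
      · by_cases h : x n = x m <;> simp [h]
      · intro b _ hb; simp [hb]
      · simp
    rw [h1]
    refine (norm_sum_le _ _).trans ?_
    have h2 : (∑ p : Fin K × (Fin N → Fin d),
        ‖if p.2 n = p.2 m then w m p.1 p.2 * star (w n p.1 p.2) else 0‖) ^ 2
        ≤ (d * y m) * (d * y n) := by
      rw [← hhalf n m hnm, ← hhalf m n hnm.symm, ← Fintype.sum_prod_type',
        ← Fintype.sum_prod_type']
      refine le_trans (le_of_eq ?_) ((Finset.sum_mul_sq_le_sq_mul_sq Finset.univ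
        (fun p : Fin K × (Fin N → Fin d) => if p.2 n = p.2 m then ‖w m p.1 p.2‖ else 0)
        (fun p => if p.2 n = p.2 m then ‖w n p.1 p.2‖ else 0)).trans (le_of_eq ?_))
      · congr 1
        refine Finset.sum_congr rfl fun p _ => ?_
        split_ifs <;> simp
      · congr 1 <;> refine Finset.sum_congr rfl fun p _ => ?_
        · simp only [eq_comm (a := p.2 m)]; split_ifs <;> simp
        · split_ifs <;> simp
    refine abs_le_of_sq_le_sq' ?_ (by positivity) |>.2
    refine h2.trans (le_of_eq ?_)
    rw [mul_pow, mul_pow, Real.sq_sqrt (hy n), Real.sq_sqrt (hy m)]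
    ring

/-! ### Explicit cloners -/

/-- The completely positive map with Kraus operators `K k`. -/
noncomputable def krausMap {d N : ℕ} {κ : Type*} [Fintype κ]
    (K : κ → Matrix (Fin N → Fin d) (Fin d) ℂ) :
    Matrix (Fin d) (Fin d) ℂ →ₗ[ℂ] Matrix (Fin N → Fin d) (Fin N → Fin d) ℂ where
  toFun X := ∑ k, K k * X * (K k).conjTranspose
  map_add' X Y := by simp [Matrix.mul_add, Matrix.add_mul, Finset.sum_add_distrib]
  map_smul' c X := by simp [Finset.smul_sum]

lemma krausMap_apply {d N : ℕ} {κ : Type*} [Fintype κ]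
    (K : κ → Matrix (Fin N → Fin d) (Fin d) ℂ) (X : Matrix (Fin d) (Fin d) ℂ) :
    krausMap K X = ∑ k, K k * X * (K k).conjTranspose := rfl

lemma isCompletelyPositive_krausMap {d N : ℕ} {κ : Type*} [Fintype κ]
    (K : κ → Matrix (Fin N → Fin d) (Fin d) ℂ) : IsCompletelyPositive (krausMap K) := by
  intro r X hX
  let L : κ → Matrix (Fin r × (Fin N → Fin d)) (Fin r × Fin d) ℂ := fun k =>
    Matrix.of fun p q => if p.1 = q.1 then K k p.2 q.2 else 0
  have h : (Matrix.of fun p q : Fin r × (Fin N → Fin d) =>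
      krausMap K (Matrix.of fun i j => X (p.1, i) (q.1, j)) p.2 q.2)
      = ∑ k, L k * X * (L k).conjTranspose := by
    ext p q
    simp only [krausMap_apply, Matrix.of_apply, Matrix.sum_apply, Matrix.mul_apply,
      Matrix.conjTranspose_apply, Fintype.sum_prod_type, L]
    refine Finset.sum_congr rfl fun k _ => ?_
    simp [Finset.sum_ite_irrel, apply_ite]
  rw [h]
  exact Matrix.posSemidef_sum _ fun k _ => hX.mul_mul_conjTranspose_same (L k)

lemma isCloner_krausMap {d N : ℕ} {κ : Type*} [Fintype κ]
    {K : κ → Matrix (Fin N → Fin d) (Fin d) ℂ}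
    (hK : ∑ k, (K k).conjTranspose * K k = 1) : IsCloner (krausMap K) := by
  refine ⟨isCompletelyPositive_krausMap K, fun X => ?_⟩
  rw [krausMap_apply, Matrix.trace_sum]
  simp_rw [Matrix.mul_assoc, fun k => Matrix.trace_mul_comm (K k) (X * (K k).conjTranspose),
    Matrix.mul_assoc, ← Matrix.trace_sum, ← Finset.mul_sum, hK, mul_one]

/-- The amplitude of `x` in `∑ m, β m |a⋯a i a⋯a⟩`, with `i` on site `m`. -/
noncomputable def cloneAmp {d N : ℕ} (β : Fin N → ℝ) (a i : Fin d) (x : Fin N → Fin d) : ℝ :=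
  ∑ m, if x = Function.update (fun _ => a) m i then β m else 0

/-- For `i = j`, insertions at the same site agree for all `d` values of `a`, those at different
sites only for `a = i`; hence the matrix `(d-1)1 + J`. -/
lemma sum_cloneAmp_mul {d N : ℕ} (β : Fin N → ℝ) (i j : Fin d) :
    ∑ a, ∑ x, cloneAmp β a i x * cloneAmp β a j x =
      if i = j then (d - 1) * ∑ m, β m ^ 2 + (∑ m, β m) ^ 2 else 0 := by
  have h1 : ∀ a, ∑ x, cloneAmp β a i x * cloneAmp β a j x =
      ∑ m, ∑ m', β m * β m' * (if m = m' then (if i = j then 1 else 0)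
        else if a = i ∧ i = j then 1 else 0) := by
    intro a
    simp only [cloneAmp, Finset.sum_mul_sum]
    rw [Finset.sum_comm]
    refine Finset.sum_congr rfl fun m _ => ?_
    rw [Finset.sum_comm]
    refine Finset.sum_congr rfl fun m' _ => ?_
    simp only [ite_mul, zero_mul, Finset.sum_ite_eq', Finset.mem_univ, if_true, mul_ite, mul_zero,
      mul_one]
    by_cases hm : m = m'
    · subst hm
      simp only [if_true]
      by_cases hij : i = j
      · simp [hij]
      · rw [if_neg, if_neg hij]
        intro h
        exact hij (by simpa using (congrFun h m).symm)
    · rw [if_neg hm]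
      by_cases hc : a = i ∧ i = j
      · obtain ⟨rfl, rfl⟩ := hc
        simp
      · rw [if_neg hc, if_neg]
        intro h
        have e1 := congrFun h m
        have e2 := congrFun h m'
        simp [hm, Ne.symm hm] at e1 e2
        exact hc ⟨e1, (e2.trans e1).symm⟩
  simp_rw [h1]
  by_cases hij : i = j
  · subst hij
    simp only [if_true, and_true]
    rw [Finset.sum_comm]
    simp_rw [Finset.sum_comm (s := Finset.univ (α := Fin d)) (t := Finset.univ (α := Fin N)),
      ← Finset.mul_sum]
    have h2 : ∀ m m' : Fin N, (∑ a : Fin d, if m = m' then (1 : ℝ) else if a = i then 1 else 0)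
        = 1 + if m = m' then (d - 1 : ℝ) else 0 := by
      intro m m'
      by_cases hm : m = m' <;> simp [hm]
    simp_rw [h2, mul_add, Finset.sum_add_distrib]
    simp only [mul_one, mul_ite, mul_zero, Finset.sum_ite_eq, Finset.mem_univ, if_true]
    rw [sq (∑ m, β m), Finset.sum_mul_sum, add_comm, Finset.mul_sum]
    congr 1
    exact Finset.sum_congr rfl fun m _ => by ring
  · simp [hij]

/-- When `z` equals `a` away from `n`, the term `m = n` contributes for all `d` values of `i`, every
other term only for `i = a`. -/
lemma sum_cloneAmp_update {d N : ℕ} (β : Fin N → ℝ) (a : Fin d) (n : Fin N) (z : Fin N → Fin d) :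
    ∑ i, cloneAmp β a i (Function.update z n i) =
      if z = Function.update (fun _ => a) n (z n) then (d - 1) * β n + ∑ m, β m else 0 := by
  have h1 : ∀ m i, Function.update z n i = Function.update (fun _ => a) m i ↔
      z = Function.update (fun _ => a) n (z n) ∧ (m = n ∨ i = a) := by
    intro m i
    simp only [funext_iff]
    constructor
    · intro h
      by_cases hm : m = n
      · subst hm
        refine ⟨fun k => ?_, Or.inl rfl⟩
        by_cases hk : k = m
        · subst hk; simp
        · simpa [hk] using h k
      · have hi : i = a := by simpa [Ne.symm hm] using h n
        refine ⟨fun k => ?_, Or.inr hi⟩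
        subst hi
        by_cases hk : k = n
        · subst hk; simp
        · simpa [hk] using h k
    · rintro ⟨h, rfl | rfl⟩ k
      · by_cases hk : k = m
        · subst hk; simp
        · simpa [hk] using h k
      · by_cases hk : k = n
        · subst hk; simp
        · simpa [hk] using h k
  simp only [cloneAmp, h1, ite_and]
  split_ifs with hz
  · rw [Finset.sum_comm]
    have h2 : ∀ m : Fin N, (∑ i : Fin d, if m = n ∨ i = a then β m else 0)
        = β m + if m = n then (d - 1) * β m else 0 := by
      intro m
      by_cases hm : m = n
      · simp [hm]; ring
      · simp [hm]
    simp_rw [h2, Finset.sum_add_distrib]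
    simp [add_comm]
  · simp

theorem achievable_of_amplitudes {d N : ℕ} [NeZero d] {β : Fin N → ℝ}
    (hβ : (d - 1) * ∑ m, β m ^ 2 + (∑ m, β m) ^ 2 = 1) {F : Fin N → ℝ}
    (hF : ∀ n, F n * (d + 1) - 1 = ((d - 1) * β n + ∑ m, β m) ^ 2) : Achievable d F := by
  let K : Fin d → Matrix (Fin N → Fin d) (Fin d) ℂ :=
    fun a => Matrix.of fun x i => (cloneAmp β a i x : ℂ)
  have hK : ∑ k, (K k).conjTranspose * K k = 1 := by
    ext i j
    have h := sum_cloneAmp_mul (d := d) β i j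
    rw [hβ] at h
    simp only [Matrix.sum_apply, Matrix.mul_apply, Matrix.conjTranspose_apply, K, Matrix.of_apply,
      Complex.star_def, Complex.conj_ofReal, Matrix.one_apply]
    have h' := congrArg Complex.ofReal h
    push_cast at h'
    rw [h']
    split_ifs <;> simp
  have hE := isCloner_krausMap hK
  refine ⟨krausMap K, hE, fun n => ?_⟩
  have hkr : IsKraus (krausMap K) (fun a i x => (cloneAmp β a i x : ℂ)) := by
    intro i j x y
    rw [krausMap_apply, Matrix.sum_apply]
    refine Finset.sum_congr rfl fun a _ => ?_
    simp [Matrix.mul_apply, K, Matrix.single_apply, ite_and]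
  have hd : (d : ℝ) ≠ 0 := Nat.cast_ne_zero.2 (NeZero.ne d)
  have h := congrArg Complex.re (overlap_eq_of_isKraus hkr n)
  rw [Complex.ofReal_re, ← Complex.ofReal_natCast, Complex.re_ofReal_mul] at h
  simp_rw [← Complex.ofReal_sum, Complex.norm_real, Real.norm_eq_abs, sq_abs,
    sum_cloneAmp_update] at h
  -- The admissible `z` are constant `a` away from `n`, with `z n` free.
  have hcount : ∀ (a : Fin d) (t : ℝ), ∑ z : Fin N → Fin d,
      (if z = Function.update (fun _ => a) n (z n) then t else 0) ^ 2 = d * t ^ 2 := by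
    intro a t
    simp only [ite_pow, zero_pow two_ne_zero]
    rw [← Finset.sum_filter, Finset.sum_const, nsmul_eq_mul]
    congr 2
    refine (Finset.card_bij' (t := Finset.univ) (fun z _ => z n)
      (fun i _ => Function.update (fun _ => a) n i) ?_ ?_ ?_ ?_).trans (Finset.card_fin d)
    · simp
    · simp
    · intro z hz; exact (Finset.mem_filter.1 hz).2.symm
    · simp
  simp_rw [hcount] at h
  have h2 := fidelity_eq_overlap hE.tracePreserving n
  have hd1 : (d : ℝ) + 1 ≠ 0 := by positivity
  have h3 : fidelity (krausMap K) n * (d + 1) - 1 = F n * (d + 1) - 1 := by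
    rw [h2, hF]
    simp at h
    field_simp
    rcases h with h | h
    · linarith
    · exact absurd h (NeZero.ne d)
  exact mul_right_cancel₀ hd1 (by linarith)

/-! ### The form `e • 1 + J` on the nonnegative orthant -/

/-- The quadratic form of the matrix `e • 1 + J`, with `J` the all-ones matrix. -/
def gramForm {ι : Type*} [Fintype ι] (e : ℝ) (b : ι → ℝ) : ℝ :=
  e * ∑ n, b n ^ 2 + (∑ n, b n) ^ 2

/-- Multiplication by the matrix `e • 1 + J`, with `J` the all-ones matrix. -/
def gramMul {ι : Type*} [Fintype ι] (e : ℝ) (b : ι → ℝ) (n : ι) : ℝ :=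
  e * b n + ∑ m, b m

lemma gramForm_nonneg {ι : Type*} [Fintype ι] {e : ℝ} (he : 0 < e) (b : ι → ℝ) :
    0 ≤ gramForm e b :=
  add_nonneg (mul_nonneg he.le (Finset.sum_nonneg fun _ _ => sq_nonneg _)) (sq_nonneg _)

lemma gramForm_pos {ι : Type*} [Fintype ι] {e : ℝ} (he : 0 < e) {b : ι → ℝ} (hb : b ≠ 0) :
    0 < gramForm e b := by
  obtain ⟨n, hn⟩ := Function.ne_iff.1 hb
  have : 0 < ∑ n, b n ^ 2 :=
    Finset.sum_pos' (fun _ _ => sq_nonneg _) ⟨n, Finset.mem_univ n, by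
      have : b n ≠ 0 := hn
      positivity⟩
  unfold gramForm
  positivity

lemma sum_mul_gramMul {ι : Type*} [Fintype ι] (e : ℝ) (b c : ι → ℝ) :
    ∑ n, b n * gramMul e c n = e * ∑ n, b n * c n + (∑ n, b n) * ∑ n, c n := by
  simp only [gramMul, mul_add, Finset.sum_add_distrib, ← Finset.sum_mul]
  congr 1
  rw [Finset.mul_sum]
  exact Finset.sum_congr rfl fun n _ => by ring

lemma sum_mul_gramMul_self {ι : Type*} [Fintype ι] (e : ℝ) (b : ι → ℝ) :
    ∑ n, b n * gramMul e b n = gramForm e b := by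
  rw [sum_mul_gramMul, gramForm]
  simp only [sq]

lemma gramForm_add_mul {ι : Type*} [Fintype ι] (e t : ℝ) (b c : ι → ℝ) :
    gramForm e (fun n => b n + t * c n) =
      gramForm e b + 2 * t * ∑ n, c n * gramMul e b n + t ^ 2 * gramForm e c := by
  rw [sum_mul_gramMul]
  simp only [gramForm, Finset.sum_add_distrib, ← Finset.mul_sum]
  have : ∑ n, (b n + t * c n) ^ 2 = ∑ n, b n ^ 2 + 2 * t * ∑ n, c n * b n + t ^ 2 * ∑ n, c n ^ 2 := by
    simp only [Finset.mul_sum, ← Finset.sum_add_distrib]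
    exact Finset.sum_congr rfl fun n _ => by ring
  rw [this]; ring

lemma gramForm_mul {ι : Type*} [Fintype ι] (e t : ℝ) (b : ι → ℝ) :
    gramForm e (fun n => t * b n) = t ^ 2 * gramForm e b := by
  simp only [gramForm, mul_pow, ← Finset.mul_sum]; ring

lemma gramMul_mul {ι : Type*} [Fintype ι] (e t : ℝ) (b : ι → ℝ) (n : ι) :
    gramMul e (fun n => t * b n) n = t * gramMul e b n := by
  simp only [gramMul, ← Finset.mul_sum]; ring

lemma gramMul_nonneg {ι : Type*} [Fintype ι] {e : ℝ} (he : 0 < e) {b : ι → ℝ}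
    (hb : ∀ n, 0 ≤ b n) (n : ι) : 0 ≤ gramMul e b n :=
  add_nonneg (mul_nonneg he.le (hb n)) (Finset.sum_nonneg fun m _ => hb m)

lemma gramForm_single {ι : Type*} [Fintype ι] [DecidableEq ι] (e : ℝ) (n : ι) :
    gramForm e (Pi.single n 1) = e + 1 := by
  simp [gramForm, Pi.single_apply, ite_pow]

lemma continuous_gramForm {ι : Type*} [Fintype ι] (e : ℝ) :
    Continuous (gramForm e : (ι → ℝ) → ℝ) := by
  unfold gramForm; fun_prop

/-- Nonnegative least squares for the form `gramForm e`: a minimiser of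
`gramForm e b - 2 * ∑ n, b n * x n` over the nonnegative orthant satisfies the optimality conditions. -/
lemma exists_nonneg_least_squares {ι : Type*} [Fintype ι] {e : ℝ} (he : 1 ≤ e) (x : ι → ℝ)
    (hx : ∀ n, 0 ≤ x n) :
    ∃ β : ι → ℝ, (∀ n, 0 ≤ β n) ∧ (∀ n, x n ≤ gramMul e β n) ∧
      gramForm e β ≤ ∑ n, β n * x n := by
  classical
  have he0 : 0 < e := by linarith
  set S := ∑ n, x n ^ 2 with hS
  have hS0 : 0 ≤ S := Finset.sum_nonneg fun _ _ => sq_nonneg _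
  set f : (ι → ℝ) → ℝ := fun b => gramForm e b - 2 * ∑ n, b n * x n with hf
  have hfc : Continuous f := by
    have := continuous_gramForm (ι := ι) e
    fun_prop
  -- The box only supplies compactness. Comparison with `f 0 = 0`, using `e ≥ 1`, puts `β` within
  -- `√S` of `x`, hence strictly below the upper faces.
  obtain ⟨β, hβ, hmin⟩ := (isCompact_Icc (a := (0 : ι → ℝ)) (b := fun _ => S + 2)).exists_isMinOn
    ⟨0, le_refl _, fun n => by simp only [Pi.zero_apply]; linarith⟩ hfc.continuousOn
  have hβ0 : ∀ n, 0 ≤ β n := hβ.1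
  have hlt : ∀ n, β n < S + 2 := by
    intro n
    have h0 : f β ≤ f 0 := hmin ⟨le_refl _, fun n => by simp only [Pi.zero_apply]; linarith⟩
    have h1 : f 0 = 0 := by simp [hf, gramForm]
    have h2 : ∑ m, (β m - x m) ^ 2 ≤ S := by
      have h3 : ∑ m, (β m - x m) ^ 2 = ∑ m, β m ^ 2 - 2 * ∑ m, β m * x m + S := by
        rw [hS, Finset.mul_sum, ← Finset.sum_sub_distrib, ← Finset.sum_add_distrib]
        exact Finset.sum_congr rfl fun m _ => by ring
      have h4 : ∑ m, β m ^ 2 ≤ gramForm e β := by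
        have : 0 ≤ ∑ m, β m ^ 2 := Finset.sum_nonneg fun _ _ => sq_nonneg _
        unfold gramForm
        nlinarith [sq_nonneg (∑ m, β m)]
      rw [h1] at h0
      simp only [hf] at h0
      linarith
    have h5 : (β n - x n) ^ 2 ≤ S :=
      (Finset.single_le_sum (f := fun m => (β m - x m) ^ 2) (fun _ _ => sq_nonneg _)
        (Finset.mem_univ n)).trans h2
    have h6 : x n ^ 2 ≤ S :=
      Finset.single_le_sum (f := fun m => x m ^ 2) (fun _ _ => sq_nonneg _) (Finset.mem_univ n)
    nlinarith [sq_nonneg (β n - x n - 1), sq_nonneg (x n - 1)]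
  refine ⟨β, hβ0, fun n => ?_, ?_⟩
  · by_contra! hlt'
    -- Raising coordinate `n` by `t` changes `f` by `2 t (gramMul e β n - x n) + t² (e + 1)`. The
    -- first bound on `t` stays in the box, the second makes the change negative.
    set t := min (S + 2 - β n) ((x n - gramMul e β n) / (e + 1)) with ht
    have ht0 : 0 < t := lt_min (by linarith [hlt n]) (div_pos (by linarith) (by linarith))
    have ht1 : t * (e + 1) ≤ x n - gramMul e β n :=
      (le_div_iff₀ (by linarith)).1 (min_le_right _ _)
    have ht2 : t ≤ S + 2 - β n := min_le_left _ _
    have hmem : (fun m => β m + t * (Pi.single n 1 : ι → ℝ) m) ∈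
        Set.Icc (0 : ι → ℝ) (fun _ => S + 2) := by
      refine ⟨fun m => ?_, fun m => ?_⟩ <;> by_cases hm : m = n
      · subst hm; simp; linarith [hβ0 m]
      · simpa [hm] using hβ0 m
      · subst hm; simp; linarith
      · simpa [hm] using hβ.2 m
    have h := hmin hmem
    have hexp : f (fun m => β m + t * (Pi.single n 1 : ι → ℝ) m)
        = f β + 2 * t * (gramMul e β n - x n) + t ^ 2 * (e + 1) := by
      simp only [hf, gramForm_add_mul, gramForm_single, add_mul, Finset.sum_add_distrib, mul_assoc,
        ← Finset.mul_sum]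
      simp only [Pi.single_apply, ite_mul, one_mul, zero_mul, Finset.sum_ite_eq', Finset.mem_univ,
        if_true]
      ring
    simp only [Set.mem_ofPred_eq, hexp] at h
    nlinarith
  · by_contra! hlt'
    have hb : 0 ≤ ∑ n, β n * x n := Finset.sum_nonneg fun n _ => mul_nonneg (hβ0 n) (hx n)
    set q := gramForm e β with hq
    set s := ∑ n, β n * x n with hs
    have hq0 : 0 < q := by linarith
    have hsq : s / q < 1 := (div_lt_one hq0).2 hlt'
    have hsq0 : 0 ≤ s / q := div_nonneg hb hq0.le
    -- The factor `s / q` minimises `f` along the ray through `β`; moving there would lower `f` by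
    -- `(q - s)² / q`.
    have hmem : (fun m => s / q * β m) ∈ Set.Icc (0 : ι → ℝ) (fun _ => S + 2) := by
      refine ⟨fun m => mul_nonneg hsq0 (hβ0 m), fun m => ?_⟩
      have := hlt m
      have := hβ0 m
      simp only
      nlinarith
    have h := hmin hmem
    have hexp : f (fun m => s / q * β m) = (s / q) ^ 2 * q - 2 * (s / q * s) := by
      simp only [hf, gramForm_mul, mul_assoc, ← Finset.mul_sum, ← hs, ← hq]
    simp only [Set.mem_ofPred_eq, hexp] at h
    simp only [hf, ← hs, ← hq] at h
    have h1 : (s / q) ^ 2 * q - 2 * (s / q * s) = - s ^ 2 / q := by field_simp; ring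
    rw [h1, le_div_iff₀ hq0] at h
    nlinarith [mul_pos (sub_pos.2 hlt') (sub_pos.2 hlt')]

/-- For the least-squares solution `β`, `(β·x)² ≤ β·Gβ ≤ β·x` forces `β·Gβ ≤ 1`, so normalising can
only enlarge `Gβ`. If `β = 0` then `x ≤ 0`, and any normalised nonnegative vector serves. -/
lemma exists_dominating {ι : Type*} [Fintype ι] [Nonempty ι] {e : ℝ} (he : 1 ≤ e) {x : ι → ℝ}
    (hx : ∀ n, 0 ≤ x n)
    (h : ∀ b : ι → ℝ, (∀ n, 0 ≤ b n) → (∑ n, b n * x n) ^ 2 ≤ gramForm e b) :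
    ∃ β : ι → ℝ, (∀ n, 0 ≤ β n) ∧ gramForm e β = 1 ∧ ∀ n, x n ≤ gramMul e β n := by
  have he0 : 0 < e := by linarith
  have normalise : ∀ b : ι → ℝ, (∀ n, 0 ≤ b n) → b ≠ 0 →
      gramForm e (fun n => (√(gramForm e b))⁻¹ * b n) = 1 := by
    intro b _ hb
    have hq := gramForm_pos he0 hb
    rw [gramForm_mul, inv_pow, Real.sq_sqrt hq.le, inv_mul_cancel₀ hq.ne']
  obtain ⟨β, hβ, hdom, hq⟩ := exists_nonneg_least_squares he x hx
  by_cases h0 : β = 0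
  · refine ⟨fun n => (√(gramForm e (1 : ι → ℝ)))⁻¹ * (1 : ι → ℝ) n, fun n => ?_,
      normalise _ (fun n => zero_le_one) one_ne_zero, fun n => ?_⟩
    · exact mul_nonneg (inv_nonneg.2 (Real.sqrt_nonneg _)) zero_le_one
    · refine (hdom n).trans ?_
      rw [h0]
      refine le_trans (le_of_eq (by simp [gramMul])) (gramMul_nonneg he0 (fun m => ?_) n)
      exact mul_nonneg (inv_nonneg.2 (Real.sqrt_nonneg _)) zero_le_one
  · have hpos := gramForm_pos he0 h0
    have hle : gramForm e β ≤ 1 := by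
      have := h β hβ
      nlinarith
    refine ⟨_, fun n => mul_nonneg (inv_nonneg.2 (Real.sqrt_nonneg _)) (hβ n),
      normalise β hβ h0, fun n => ?_⟩
    rw [gramMul_mul]
    refine (hdom n).trans (le_mul_of_one_le_left (gramMul_nonneg he0 hβ n) ?_)
    exact (one_le_inv₀ (Real.sqrt_pos.2 hpos)).2 (Real.sqrt_le_one.2 hle)

/-- Pairing the inequality with `β ≥ 0` gives `β·Gβ' ≥ 1`, so in the norm of `G` the squared
distance `2 - 2 β·Gβ'` is not positive. -/
lemma eq_of_gramMul_le {ι : Type*} [Fintype ι] {e : ℝ} (he : 0 < e) {β β' : ι → ℝ}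
    (hβ : ∀ n, 0 ≤ β n) (h1 : gramForm e β = 1) (h1' : gramForm e β' = 1)
    (h : ∀ n, gramMul e β n ≤ gramMul e β' n) : β = β' := by
  have hle : gramForm e β ≤ ∑ n, β n * gramMul e β' n := by
    rw [← sum_mul_gramMul_self]
    exact Finset.sum_le_sum fun n _ => mul_le_mul_of_nonneg_left (h n) (hβ n)
  have hexp := gramForm_add_mul e (-1) β' β
  by_contra hne
  have hpos := gramForm_pos he (b := fun n => β' n + -1 * β n) (fun h0 => hne ?_)
  · linarith
  · funext n
    have := congrFun h0 n
    simp only [Pi.zero_apply] at this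
    linarith

/-- The weights `β n / x n`, for `x = gramMul e β`, support the feasible region at `x ^ 2`. -/
lemma sum_weights_le_one {ι : Type*} [Fintype ι] {e : ℝ} {β y : ι → ℝ}
    (hβ : ∀ n, 0 ≤ β n) (hx : ∀ n, 0 < gramMul e β n) (hy : ∀ n, 0 ≤ y n)
    (h : ∀ γ : ι → ℝ, (∀ n, 0 ≤ γ n) →
      (∑ n, γ n * y n) ^ 2 ≤ e * ∑ n, γ n ^ 2 * y n + (∑ n, γ n * √(y n)) ^ 2) :
    ∑ n, β n / gramMul e β n * y n ≤ 1 := by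
  set x := gramMul e β with hxdef
  set γ : ι → ℝ := fun n => β n / x n with hγ
  have hγ0 : ∀ n, 0 ≤ γ n := fun n => div_nonneg (hβ n) (hx n).le
  -- Cauchy-Schwarz with weights `β n`. Since `x n = e * β n + ∑ m, β m`, the bound in `h` then
  -- collapses to `(∑ γ y)² ≤ ∑ γ y`.
  have hcs : (∑ n, γ n * √(y n)) ^ 2 ≤ (∑ n, β n) * ∑ n, γ n * y n / x n := by
    have h1 := Finset.sum_mul_sq_le_sq_mul_sq Finset.univ (fun n => √(β n))
      (fun n => √(β n) * √(y n) / x n)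
    refine le_trans (le_of_eq ?_) (h1.trans (le_of_eq ?_))
    · congr 1
      refine Finset.sum_congr rfl fun n _ => ?_
      rw [mul_div_assoc, ← mul_assoc, Real.mul_self_sqrt (hβ n), hγ]
      ring
    · congr 1 <;> refine Finset.sum_congr rfl fun n _ => ?_
      · rw [Real.sq_sqrt (hβ n)]
      · rw [div_pow, mul_pow, Real.sq_sqrt (hβ n), Real.sq_sqrt (hy n), hγ]
        have := (hx n).ne'
        field_simp
  have hP : e * ∑ n, γ n ^ 2 * y n + (∑ n, β n) * ∑ n, γ n * y n / x n = ∑ n, γ n * y n := by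
    rw [Finset.mul_sum, Finset.mul_sum, ← Finset.sum_add_distrib]
    refine Finset.sum_congr rfl fun n _ => ?_
    have hne := (hx n).ne'
    have hxn : x n = e * β n + ∑ m, β m := rfl
    have : γ n * x n = β n := div_mul_cancel₀ _ hne
    rw [← mul_right_inj' hne]
    field_simp
    rw [← sub_eq_zero]
    linear_combination (e * γ n * y n) * this - γ n * y n * hxn
  have h2 := h γ hγ0
  have h3 : 0 ≤ ∑ n, γ n * y n := Finset.sum_nonneg fun n _ => mul_nonneg (hγ0 n) (hy n)
  change ∑ n, γ n * y n ≤ 1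
  by_contra! h4
  nlinarith

/-! ### The trade-off surface and optimality -/

/-- `F` lies on the trade-off surface: it is the fidelity vector of the cloner with normalised
nonnegative amplitudes `β`. -/
def OnSurface (d : ℕ) {N : ℕ} (F : Fin N → ℝ) (β : Fin N → ℝ) : Prop :=
  (∀ n, 0 ≤ β n) ∧ gramForm ((d : ℝ) - 1) β = 1 ∧
    ∀ n, F n * ((d : ℝ) + 1) - 1 = gramMul ((d : ℝ) - 1) β n ^ 2

lemma OnSurface.achievable {d N : ℕ} [NeZero d] {F β : Fin N → ℝ} (h : OnSurface d F β) :
    Achievable d F :=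
  achievable_of_amplitudes h.2.1 h.2.2

lemma onSurface_of_amplitudes {d N : ℕ} {β : Fin N → ℝ} (hβ : ∀ n, 0 ≤ β n)
    (h1 : gramForm ((d : ℝ) - 1) β = 1) :
    OnSurface d (fun n => (gramMul ((d : ℝ) - 1) β n ^ 2 + 1) / ((d : ℝ) + 1)) β := by
  refine ⟨hβ, h1, fun n => ?_⟩
  have : (d : ℝ) + 1 ≠ 0 := by positivity
  field_simp
  ring

lemma gramMul_pos_of_gramForm_eq_one {ι : Type*} [Fintype ι] {e : ℝ} (he : 0 < e) {β : ι → ℝ}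
    (hβ : ∀ n, 0 ≤ β n) (h1 : gramForm e β = 1) : 0 < ∑ m, β m ∧ ∀ n, 0 < gramMul e β n := by
  have hS : 0 < ∑ m, β m := by
    refine lt_of_le_of_ne (Finset.sum_nonneg fun m _ => hβ m) fun h0 => ?_
    have hz : ∀ m, β m = 0 := fun m =>
      (Finset.sum_eq_zero_iff_of_nonneg fun m _ => hβ m).1 h0.symm m (Finset.mem_univ m)
    simp [gramForm, hz] at h1
  exact ⟨hS, fun n => add_pos_of_nonneg_of_pos (mul_nonneg he.le (hβ n)) hS⟩

/-- Summing `x = Gβ` gives `∑ x = (N+d-1) ∑ β`, so `β_n = (x_n - b)/(d-1)` with `b = ∑ x / (N+d-1)`.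
The normalisation of `β` becomes the trade-off equation, and `β ≥ 0` the final inequality. -/
lemma exists_onSurface_iff {d N : ℕ} (hd : 2 ≤ d) (F : Fin N → ℝ) :
    (∃ β, OnSurface d F β) ↔
      (∀ n, 1 / ((d : ℝ) + 1) ≤ F n) ∧
      ((d : ℝ) + 1) * (∑ n, F n) / ((N : ℝ) + d - 1)
        = 1 + ((∑ n, √(F n * ((d : ℝ) + 1) - 1)) / ((N : ℝ) + d - 1)) ^ 2 ∧
      (∀ n, (∑ m, √(F m * ((d : ℝ) + 1) - 1)) / ((N : ℝ) + d - 1)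
        ≤ √(F n * ((d : ℝ) + 1) - 1)) := by
  have hd2 : (2 : ℝ) ≤ d := by exact_mod_cast hd
  have he : (0 : ℝ) < d - 1 := by linarith
  have hN0 : (0 : ℝ) ≤ N := Nat.cast_nonneg N
  have hD : (0 : ℝ) < N + d - 1 := by linarith
  have hsum : ∑ n, (F n * ((d : ℝ) + 1) - 1) = (d + 1) * ∑ n, F n - N := by
    simp [Finset.sum_sub_distrib, ← Finset.sum_mul, mul_comm]
  constructor
  · rintro ⟨β, hβ, h1, hF⟩
    have hx : ∀ n, √(F n * ((d : ℝ) + 1) - 1) = gramMul ((d : ℝ) - 1) β n := fun n => by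
      rw [hF, Real.sqrt_sq (gramMul_nonneg he hβ n)]
    have hS : ∑ n, gramMul ((d : ℝ) - 1) β n = (N + d - 1) * ∑ m, β m := by
      simp only [gramMul, Finset.sum_add_distrib, ← Finset.mul_sum, Finset.sum_const,
        Finset.card_univ, Fintype.card_fin, nsmul_eq_mul]
      ring
    simp only [hx, hS, mul_div_cancel_left₀ _ hD.ne']
    refine ⟨fun n => ?_, ?_, fun n => ?_⟩
    · rw [div_le_iff₀ (by linarith)]
      nlinarith [hF n, sq_nonneg (gramMul ((d : ℝ) - 1) β n)]
    · have h2 : ∑ n, gramMul ((d : ℝ) - 1) β n ^ 2 = (d - 1) + (N + d - 1) * (∑ m, β m) ^ 2 := by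
        have h3 : ∑ n, gramMul ((d : ℝ) - 1) β n ^ 2 = (d - 1) * gramForm ((d : ℝ) - 1) β
            + (∑ m, β m) * ∑ n, gramMul ((d : ℝ) - 1) β n := by
          rw [← sum_mul_gramMul_self, Finset.mul_sum, Finset.mul_sum, ← Finset.sum_add_distrib]
          refine Finset.sum_congr rfl fun n _ => ?_
          rw [gramMul]; ring
        rw [h3, h1, hS]; ring
      simp only [hF, h2] at hsum
      rw [div_eq_iff hD.ne']
      linarith
    · exact le_add_of_nonneg_left (mul_nonneg he.le (hβ n))
  · rintro ⟨hlow, htrade, hge⟩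
    have hy : ∀ n, 0 ≤ F n * ((d : ℝ) + 1) - 1 := fun n => by
      have := (div_le_iff₀ (by linarith)).1 (hlow n)
      linarith
    set x : Fin N → ℝ := fun n => √(F n * ((d : ℝ) + 1) - 1) with hx
    have hx2 : ∀ n, F n * ((d : ℝ) + 1) - 1 = x n ^ 2 := fun n => (Real.sq_sqrt (hy n)).symm
    set b := (∑ m, x m) / ((N : ℝ) + d - 1) with hb
    have hbS : ∑ m, x m = b * (N + d - 1) := (div_mul_cancel₀ _ hD.ne').symm
    have hβ : ∑ m, (x m - b) / ((d : ℝ) - 1) = b := by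
      rw [← Finset.sum_div, Finset.sum_sub_distrib, hbS]
      simp only [Finset.sum_const, Finset.card_univ, Fintype.card_fin, nsmul_eq_mul]
      field_simp
      ring
    have hg : ∀ n, gramMul ((d : ℝ) - 1) (fun m => (x m - b) / ((d : ℝ) - 1)) n = x n := by
      intro n
      rw [gramMul, hβ]
      field_simp
      ring
    refine ⟨fun n => (x n - b) / (d - 1), fun n => div_nonneg (sub_nonneg.2 (hge n)) he.le, ?_,
      fun n => ?_⟩
    · rw [← sum_mul_gramMul_self]
      simp only [hg]
      have h2 : ∑ n, (x n - b) / ((d : ℝ) - 1) * x n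
          = (∑ n, x n ^ 2 - b * ∑ n, x n) / (d - 1) := by
        rw [Finset.mul_sum, ← Finset.sum_sub_distrib, Finset.sum_div]
        exact Finset.sum_congr rfl fun n _ => by ring
      simp only [hx2] at hsum
      rw [div_eq_iff hD.ne'] at htrade
      rw [h2, hsum, hbS, div_eq_one_iff_eq he.ne']
      linarith
    · rw [hg, hx2]

lemma Achievable.exists_le_onSurface {d N : ℕ} [NeZero d] (hd : 2 ≤ d) (hN : 2 ≤ N)
    {F : Fin N → ℝ} (hF : Achievable d F) : ∃ F' β, OnSurface d F' β ∧ F ≤ F' := by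
  obtain ⟨E, hE, hEF⟩ := hF
  obtain ⟨hy, hb⟩ := hE.fidelity_bound
  simp only [hEF] at hy hb
  have hd2 : (2 : ℝ) ≤ d := by exact_mod_cast hd
  have : Nonempty (Fin N) := ⟨⟨0, by omega⟩⟩
  set x : Fin N → ℝ := fun n => √(F n * ((d : ℝ) + 1) - 1) with hx
  have hx0 : ∀ n, 0 ≤ x n := fun n => Real.sqrt_nonneg _
  have hx2 : ∀ n, F n * ((d : ℝ) + 1) - 1 = x n ^ 2 := fun n => (Real.sq_sqrt (hy n)).symm
  obtain ⟨β, hβ, h1, hdom⟩ := exists_dominating (e := (d : ℝ) - 1) (by linarith) hx0 (by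
    intro b hb0
    -- Where `x n = 0` the quotient is `0`, so `b n / x n * x n` may fall below `b n`; only this
    -- inequality is needed on the right-hand side.
    have h := hb (fun n => b n / x n) (fun n => div_nonneg (hb0 n) (hx0 n))
    have hle : ∀ n, b n / x n * x n ≤ b n := fun n => by
      by_cases h0 : x n = 0
      · simpa [h0] using hb0 n
      · rw [div_mul_cancel₀ _ h0]
    have hnn : ∀ n, 0 ≤ b n / x n * x n :=
      fun n => mul_nonneg (div_nonneg (hb0 n) (hx0 n)) (hx0 n)
    have hlhs : ∑ n, b n * x n = ∑ n, b n / x n * (F n * (d + 1) - 1) := by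
      refine Finset.sum_congr rfl fun n _ => ?_
      rw [hx2]
      by_cases h0 : x n = 0
      · simp [h0]
      · field_simp
    rw [hlhs]
    refine h.trans (add_le_add (mul_le_mul_of_nonneg_left (Finset.sum_le_sum fun n _ => ?_)
      (by linarith)) (pow_le_pow_left₀ (Finset.sum_nonneg fun n _ => hnn n)
        (Finset.sum_le_sum fun n _ => hle n) 2))
    rw [hx2, ← mul_pow]
    exact pow_le_pow_left₀ (hnn n) (hle n) 2)
  refine ⟨_, β, onSurface_of_amplitudes hβ h1, fun n => ?_⟩
  rw [le_div_iff₀ (by linarith)]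
  have := pow_le_pow_left₀ (hx0 n) (hdom n) 2
  linarith [hx2 n]

lemma OnSurface.eq_of_le {d N : ℕ} (hd : 2 ≤ d) {F F' β β' : Fin N → ℝ}
    (h : OnSurface d F β) (h' : OnSurface d F' β') (hle : F ≤ F') : F = F' := by
  have hd2 : (2 : ℝ) ≤ d := by exact_mod_cast hd
  have he : (0 : ℝ) < d - 1 := by linarith
  have hββ : β = β' := by
    refine eq_of_gramMul_le he h.1 h.2.1 h'.2.1 fun n => ?_
    refine abs_le_of_sq_le_sq' ?_ (gramMul_nonneg he h'.1 n) |>.2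
    rw [← h.2.2, ← h'.2.2]
    nlinarith [hle n]
  subst hββ
  funext n
  have h1 := (h.2.2 n).trans (h'.2.2 n).symm
  exact mul_right_cancel₀ (by positivity : (d : ℝ) + 1 ≠ 0) (by linarith)

theorem maximal_achievable_iff {d N : ℕ} [NeZero d] (hd : 2 ≤ d) (hN : 2 ≤ N) (F : Fin N → ℝ) :
    Maximal (Achievable d) F ↔ ∃ β, OnSurface d F β := by
  constructor
  · intro hF
    obtain ⟨F', β, h, hle⟩ := hF.1.exists_le_onSurface hd hN
    have : F = F' := le_antisymm hle (hF.2 h.achievable hle)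
    exact ⟨β, this ▸ h⟩
  · rintro ⟨β, h⟩
    refine ⟨h.achievable, fun F'' hF'' hle => ?_⟩
    obtain ⟨F', β', h', hle'⟩ := hF''.exists_le_onSurface hd hN
    rw [h.eq_of_le hd h' (hle.trans hle')]
    exact hle'

/-- The normalised nonnegative amplitudes form a compact set, so the maximum over the surface
exists; domination by the surface extends it to all achievable vectors because the weights are
nonnegative. -/
lemma exists_isMaxOn_weighted {d N : ℕ} [NeZero d] (hd : 2 ≤ d) (hN : 2 ≤ N) {α : Fin N → ℝ}
    (hα : ∀ n, 0 ≤ α n) :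
    ∃ F β, OnSurface d F β ∧
      IsMaxOn (fun G : Fin N → ℝ => ∑ n, α n * G n) {G | Achievable d G} F := by
  have hd2 : (2 : ℝ) ≤ d := by exact_mod_cast hd
  have he : (0 : ℝ) < d - 1 := by linarith
  set φ : (Fin N → ℝ) → ℝ := fun β =>
    ∑ n, α n * ((gramMul ((d : ℝ) - 1) β n ^ 2 + 1) / ((d : ℝ) + 1)) with hφ
  set s : Set (Fin N → ℝ) := {β | (∀ n, 0 ≤ β n) ∧ gramForm ((d : ℝ) - 1) β = 1} with hs
  have hsc : IsCompact s := by
    refine (isCompact_Icc (a := (0 : Fin N → ℝ)) (b := fun _ => 1)).of_isClosed_subset ?_ ?_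
    · refine IsClosed.inter (s₁ := {β : Fin N → ℝ | ∀ n, 0 ≤ β n}) ?_
        (isClosed_eq (continuous_gramForm _) continuous_const)
      exact isClosed_Ici (a := (0 : Fin N → ℝ))
    · rintro β ⟨hβ, h1⟩
      refine ⟨hβ, fun n => ?_⟩
      have hS : ∑ m, β m ≤ 1 := by
        refine abs_le_of_sq_le_sq' (b := 1) ?_ zero_le_one |>.2
        have : 0 ≤ ((d : ℝ) - 1) * ∑ m, β m ^ 2 :=
          mul_nonneg he.le (Finset.sum_nonneg fun _ _ => sq_nonneg _)
        unfold gramForm at h1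
        linarith
      exact (Finset.single_le_sum (fun m _ => hβ m) (Finset.mem_univ n)).trans hS
  have hne : s.Nonempty := by
    have : Nonempty (Fin N) := ⟨⟨0, by omega⟩⟩
    obtain ⟨β, hβ, h1, -⟩ := exists_dominating (ι := Fin N) (e := (d : ℝ) - 1) (x := 0)
      (by linarith) (fun _ => le_rfl) (fun b _ => by simpa using gramForm_nonneg he b)
    exact ⟨β, hβ, h1⟩
  have hcont : ContinuousOn φ s := by
    refine Continuous.continuousOn ?_
    simp only [hφ, gramMul]
    fun_prop
  obtain ⟨β, ⟨hβ, h1⟩, hmax⟩ := hsc.exists_isMaxOn hne hcont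
  refine ⟨_, β, onSurface_of_amplitudes hβ h1, fun G hG => ?_⟩
  obtain ⟨F', β', h', hle⟩ := Achievable.exists_le_onSurface hd hN hG
  have h2 : φ β' ≤ φ β := hmax ⟨h'.1, h'.2.1⟩
  refine le_trans (Finset.sum_le_sum fun n _ => ?_) h2
  refine mul_le_mul_of_nonneg_left ?_ (hα n)
  rw [le_div_iff₀ (by linarith), ← h'.2.2]
  nlinarith [hle n]

lemma OnSurface.exists_weights {d N : ℕ} [NeZero d] (hd : 2 ≤ d) {F β : Fin N → ℝ}
    (h : OnSurface d F β) :
    ∃ α : Fin N → ℝ, (∀ n, 0 ≤ α n) ∧ ∑ n, α n = 1 ∧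
      IsMaxOn (fun G : Fin N → ℝ => ∑ n, α n * G n) {G | Achievable d G} F := by
  have hd2 : (2 : ℝ) ≤ d := by exact_mod_cast hd
  have he : (0 : ℝ) < d - 1 := by linarith
  have hd1 : (0 : ℝ) < d + 1 := by linarith
  obtain ⟨hβ, h1, hF⟩ := h
  obtain ⟨hS, hx⟩ := gramMul_pos_of_gramForm_eq_one he hβ h1
  set γ : Fin N → ℝ := fun n => β n / gramMul ((d : ℝ) - 1) β n with hγ
  have hγ0 : ∀ n, 0 ≤ γ n := fun n => div_nonneg (hβ n) (hx n).le
  have hΓ : 0 < ∑ n, γ n := by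
    obtain ⟨n, -, hn⟩ := Finset.exists_ne_zero_of_sum_ne_zero hS.ne'
    exact Finset.sum_pos' (fun n _ => hγ0 n) ⟨n, Finset.mem_univ n,
      div_pos (lt_of_le_of_ne (hβ n) (Ne.symm hn)) (hx n)⟩
  have hlin : ∀ G : Fin N → ℝ, ∑ n, γ n / (∑ m, γ m) * G n =
      (∑ n, γ n * (G n * (d + 1) - 1) + ∑ n, γ n) / ((∑ m, γ m) * (d + 1)) := by
    intro G
    rw [← Finset.sum_add_distrib, Finset.sum_div]
    refine Finset.sum_congr rfl fun n _ => ?_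
    have := hΓ.ne'
    field_simp
    ring
  refine ⟨fun n => γ n / ∑ m, γ m, fun n => div_nonneg (hγ0 n) hΓ.le, ?_, fun G hG => ?_⟩
  · rw [← Finset.sum_div, div_self hΓ.ne']
  · obtain ⟨E, hE, hEG⟩ := hG
    obtain ⟨hy, hb⟩ := hE.fidelity_bound
    simp only [hEG] at hy hb
    have hle := sum_weights_le_one hβ hx hy hb
    have heq : ∑ n, γ n * (F n * (d + 1) - 1) = 1 := by
      refine Eq.trans ?_ ((sum_mul_gramMul_self _ _).trans h1)
      refine Finset.sum_congr rfl fun n _ => ?_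
      have := (hx n).ne'
      rw [hF, hγ]
      field_simp
    simp only [Set.mem_ofPred_eq, hlin]
    rw [heq]
    gcongr

/-- For equal fidelities only the square of the root enters the trade-off equation, which becomes
linear in `f` after clearing denominators. -/
lemma exists_onSurface_const_iff {d N : ℕ} (hd : 2 ≤ d) (hN : 2 ≤ N) (f : ℝ) :
    (∃ β, OnSurface d (fun _ : Fin N => f) β) ↔
      f = (2 * (N : ℝ) + d - 1) / (((d : ℝ) + 1) * N) := by
  have hd2 : (2 : ℝ) ≤ d := by exact_mod_cast hd
  have hN2 : (2 : ℝ) ≤ N := by exact_mod_cast hN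
  have hD : (0 : ℝ) < N + d - 1 := by linarith
  have hn : Nonempty (Fin N) := ⟨⟨0, by omega⟩⟩
  have he : (0 : ℝ) < d - 1 := by linarith
  have hN0 : (0 : ℝ) < N := by linarith
  rw [exists_onSurface_iff hd]
  simp only [Finset.sum_const, Finset.card_univ, Fintype.card_fin, nsmul_eq_mul, forall_const,
    div_pow, mul_pow]
  constructor
  · rintro ⟨hlow, h, -⟩
    have hy : 0 ≤ f * ((d : ℝ) + 1) - 1 := by
      have := (div_le_iff₀ (by linarith)).1 hlow
      linarith
    rw [Real.sq_sqrt hy] at h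
    field_simp at h
    rw [eq_div_iff (by positivity)]
    apply mul_left_cancel₀ he.ne'
    linear_combination h
  · intro hf
    have hfN : f * ((d + 1) * N) = 2 * N + d - 1 := by
      rw [hf]; field_simp
    have hy : 0 ≤ f * ((d : ℝ) + 1) - 1 := by
      refine nonneg_of_mul_nonneg_left (b := (N : ℝ)) ?_ hN0
      nlinarith
    refine ⟨?_, ?_, ?_⟩
    · rw [div_le_iff₀ (by linarith)]; linarith
    · rw [Real.sq_sqrt hy]
      field_simp
      linear_combination ((d : ℝ) - 1) * hfN
    · rw [div_le_iff₀ hD]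
      nlinarith [Real.sqrt_nonneg (f * ((d : ℝ) + 1) - 1)]

end Cloning

theorem mainTheorem1 (d N : ℕ) [NeZero d] (hd : 2 ≤ d) (hN : 2 ≤ N) :
    (∀ F : Fin N → ℝ, Maximal (Cloning.Achievable d) F ↔
      (∀ n, 1 / ((d : ℝ) + 1) ≤ F n) ∧
      ((d : ℝ) + 1) * (∑ n, F n) / ((N : ℝ) + d - 1)
        = 1 + ((∑ n, √(F n * ((d : ℝ) + 1) - 1)) / ((N : ℝ) + d - 1)) ^ 2 ∧
      (∀ n, (∑ m, √(F m * ((d : ℝ) + 1) - 1)) / ((N : ℝ) + d - 1)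
        ≤ √(F n * ((d : ℝ) + 1) - 1))) ∧
    (∀ F : Fin N → ℝ, Cloning.Achievable d F →
      ∃ F' : Fin N → ℝ, Maximal (Cloning.Achievable d) F' ∧ F ≤ F') ∧
    (∀ α : Fin N → ℝ, (∀ n, 0 ≤ α n) → ∑ n, α n = 1 →
      ∃ F : Fin N → ℝ, Maximal (Cloning.Achievable d) F ∧
        IsMaxOn (fun G : Fin N → ℝ => ∑ n, α n * G n) {G | Cloning.Achievable d G} F) ∧
    (∀ F : Fin N → ℝ, Maximal (Cloning.Achievable d) F →
      ∃ α : Fin N → ℝ, (∀ n, 0 ≤ α n) ∧ ∑ n, α n = 1 ∧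
        IsMaxOn (fun G : Fin N → ℝ => ∑ n, α n * G n) {G | Cloning.Achievable d G} F) ∧
    (∀ f : ℝ, Maximal (Cloning.Achievable d) (fun _ : Fin N => f) ↔
      f = (2 * (N : ℝ) + d - 1) / (((d : ℝ) + 1) * N)) ∧
    IsGreatest {f : ℝ | Cloning.Achievable d (fun _ : Fin N => f)}
      ((2 * (N : ℝ) + d - 1) / (((d : ℝ) + 1) * N)) := by
  have hmax := Cloning.maximal_achievable_iff (d := d) (N := N) hd hN
  have hconst := Cloning.exists_onSurface_const_iff (d := d) (N := N) hd hN
  refine ⟨fun F => (hmax F).trans (Cloning.exists_onSurface_iff hd F), fun F hF => ?_,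
    fun α hα _ => ?_, fun F hF => ?_, fun f => (hmax _).trans (hconst f), ?_, fun f hf => ?_⟩
  · obtain ⟨F', β, h, hle⟩ := hF.exists_le_onSurface hd hN
    exact ⟨F', (hmax F').2 ⟨β, h⟩, hle⟩
  · obtain ⟨F, β, h, hF⟩ := Cloning.exists_isMaxOn_weighted hd hN hα
    exact ⟨F, (hmax F).2 ⟨β, h⟩, hF⟩
  · obtain ⟨β, h⟩ := (hmax F).1 hF
    exact h.exists_weights hd
  · obtain ⟨β, h⟩ := (hconst _).2 rfl
    exact h.achievable
  · obtain ⟨β, h⟩ := (hconst _).2 rfl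
    -- Supporting weights sum to one, so on constant vectors the weighted fidelity is the constant
    -- itself.
    obtain ⟨α, -, hα, hle⟩ := h.exists_weights hd
    have := hle hf
    simpa [← Finset.sum_mul, hα] using this
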